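/- Identify the circle $\mathbb T=\mathbb R/2\pi\mathbb Z$ with $|z|=1$ via $t\mapsto e^{it}$, and let $\widehat f(n)=\frac1{2\pi}\int_0^{2\pi} f(t)e^{-int}\,dt$. A function $f$ on $\mathbb T$ is said to be in the Hardy space $H^2$ if $f\in L^2(\mathbb T)$ and $\widehat f(-n)=0$ for $n=1,2,\dots$. There is a power series $F(z)=\sum_{n\ge 0}c(n)z^n$ that converges almost everywhere on $|z|=1$ to a function $f\in L^2(\mathbb T)$ with $f\notin H^2$. Moreover, $F$ and $f$ can be chosen so that, in addition: (i) $c(n)\to 0$ as $n\to\infty$, and $f\in L^\infty(\mathbb T)$; (ii) there are a Cantor set $K\subset\mathbb T$ (nonempty, compact, without isolated points, totally disconnected) of Lebesgue measure zero and a nonzero finite positive Borel measure $\mu$ on $\mathbb T$ with $\mu(\mathbb T\setminus K)=0$ such that, for all $|z|<1$, the series converges and $$F(z)=\frac1{G(z)},\qquad G(z)=\exp\Big(-\int_{\mathbb T}\frac{e^{it}+z}{e^{it}-z}\,d\mu(t)\Big),$$ so that $G$ is a singular inner function; (iii) the partial sums $\sum_{n<N}c(n)e^{int}$ converge to $f(t)$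 uniformly on every closed arc $J\subset\mathbb T\setminus K$. -/

import Mathlib

open MeasureTheory Filter Topology

noncomputable section

/-- The circle `ℝ / 2πℤ`. A point `t` corresponds to the complex number `e^{it}`, which is
`AddCircle.toCircle t`; the Lebesgue measure normalized to have total mass one is
`AddCircle.haarAddCircle`. -/
abbrev Torus : Type := AddCircle (2 * Real.pi)

instance fact_zero_lt_two_pi : Fact (0 < 2 * Real.pi) := ⟨Real.two_pi_pos⟩

/-- The partial sum `∑_{n < N} c(n) e^{int}` of the power series with coefficients `c` at the
point `e^{it}` of the unit circle. -/
def boundaryPartialSum (c : ℕ → ℂ) (N : ℕ) (t : Torus) : ℂ :=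
  ∑ n ∈ Finset.range N, c n * (AddCircle.toCircle t : ℂ) ^ n

/-- The function `f` on the circle is in the Hardy space `H²`: it is square integrable and its
Fourier coefficients of negative order vanish. -/
def MemHardyTwo (f : Torus → ℂ) : Prop :=
  MemLp f 2 AddCircle.haarAddCircle ∧ ∀ n : ℕ, 1 ≤ n → fourierCoeff f (-(n : ℤ)) = 0

/-- `G` is, on the open unit disk, the singular inner function with measure `μ`:
`μ` is a nonzero finite positive Borel measure on the circle, singular to Lebesgue measure, and
`G(z) = exp (-∫ (e^{it} + z) / (e^{it} - z) dμ(t))` for `|z| < 1`. -/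
def IsSingularInner (G : ℂ → ℂ) (μ : Measure Torus) : Prop :=
  IsFiniteMeasure μ ∧ μ ≠ 0 ∧ Measure.MutuallySingular μ AddCircle.haarAddCircle ∧
    ∀ z : ℂ, ‖z‖ < 1 →
      G z = Complex.exp (-∫ t, ((AddCircle.toCircle t : ℂ) + z) /
        ((AddCircle.toCircle t : ℂ) - z) ∂μ)

/-- `K` is a Cantor set: nonempty, compact, without isolated points, totally disconnected. -/
def IsCantorSet (K : Set Torus) : Prop :=
  K.Nonempty ∧ IsCompact K ∧ Preperfect K ∧ IsTotallyDisconnected K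

/-- The closed arc `{e^{it} : a ≤ t ≤ b}`. -/
def closedArc (a b : ℝ) : Set Torus :=
  (fun t : ℝ => (t : Torus)) '' Set.Icc a b

end

/-!
The function `F = exp (∫ (e^{it} + z) / (e^{it} - z) dμ(t))` is the reciprocal of a singular inner
function when `μ` is singular. If `μ` is carried by a closed null set `K`, then `F` extends
analytically across the complement of `K` in the circle and is unimodular there. If moreover the
Taylor coefficients of `F` tend to zero, the Fatou–Riesz localization theorem (`fatou_riesz`) gives
uniform convergence of the power series on every closed arc off `K`, hence almost everywhere, to a
unimodular function `f`. As `f` is the complex conjugate of the boundary function of the nonconstant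
function `1 / F`, it has nonzero Fourier coefficients of negative order
(`not_memHardyTwo_expHerglotz`). Everything thus rests on a measure `μ` with null closed support for
which the Taylor coefficients of `F` tend to zero (`exists_measure_null_support`); for such a `μ`
the support is automatically a Cantor set, since an atom would make `F` grow exponentially along a
radius.

The measure is a weak limit of measures `μ_k` with density `R_k` on closed sets `E_k`, where
`E_{k+1}` is obtained from `E_k` by imposing the condition `N_k t ∈ A_k` with `A_k` an arc of
normalized length `R_k / R_{k+1}` and `N_k` a large integer. Let `c_k(n)` be the Taylor coefficients of the
function `F_k` belonging to `μ_k`.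

* All `|c_{k+1}(n) - c_k(n)|` are at most the `L¹` norm of `F_{k+1} - F_k` on circles. As
  `|F_k| ≤ e^{R_k}` and the Herglotz transform is bounded on `L²`, this is at most
  `ε_k = 2 e^{R_{k+1}} √(R_k (R_{k+1} - R_k))`. The densities `R_k` tend to infinity, so that the
  sets `E_k` shrink to a null set, but so slowly that `ε_k → 0`.
* By Fejér's lemma (`tendsto_integral_mul_comp_nsmul`), the coefficients with `n ≤ M_k` change as
  little as desired if `N_k` is large, while `c_k(n)` is already small for `n ≥ M_k` because `F_k`
  is bounded.

The essential changes therefore take place in disjoint ranges of frequencies and do not accumulate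
(`tendsto_zero_of_separated_changes`), which is why `ε_k → 0` suffices and `ε` need not be summable.
-/

/-! ### Power series on circles -/

section PowerSeries

variable {a : ℕ → ℂ} {A : ℂ → ℂ} {r : ℝ}

lemma norm_real_mul_toCircle (hr : 0 ≤ r) (t : Torus) :
    ‖(r : ℂ) * (AddCircle.toCircle t : ℂ)‖ = r := by
  rw [norm_mul, Circle.norm_coe, mul_one, Complex.norm_real, Real.norm_of_nonneg hr]

lemma fourier_natCast_apply (n : ℕ) (t : Torus) :
    fourier (n : ℤ) t = (AddCircle.toCircle t : ℂ) ^ n := by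
  rw [fourier_apply, natCast_zsmul, AddCircle.toCircle_nsmul]
  simp

lemma summable_norm_mul_pow (h : ∀ z : ℂ, ‖z‖ < 1 → HasSum (fun n => a n * z ^ n) (A z))
    (hr : 0 ≤ r) (hr1 : r < 1) : Summable fun n => ‖a n‖ * r ^ n := by
  have := (h (r : ℂ) (by simpa [abs_of_nonneg hr] using hr1)).summable.norm
  simpa [abs_of_nonneg hr] using this

lemma continuous_comp_circle (h : ∀ z : ℂ, ‖z‖ < 1 → HasSum (fun n => a n * z ^ n) (A z))
    (hr : 0 ≤ r) (hr1 : r < 1) :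
    Continuous fun t : Torus => A (r * (AddCircle.toCircle t : ℂ)) := by
  have hA : (fun t : Torus => A (r * (AddCircle.toCircle t : ℂ))) =
      fun t : Torus => ∑' n, a n * (r * (AddCircle.toCircle t : ℂ)) ^ n := by
    funext t
    exact ((h _ (by rwa [norm_real_mul_toCircle hr])).tsum_eq).symm
  rw [hA]
  refine continuous_tsum (fun n => ?_) (summable_norm_mul_pow h hr hr1) fun n t => ?_
  · have := AddCircle.continuous_toCircle (T := 2 * Real.pi)
    fun_prop
  · rw [norm_mul, norm_pow, norm_real_mul_toCircle hr]

/-- The Fourier coefficients of the restriction of a power series to the circle of radius `r`. -/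
lemma fourierCoeff_comp_circle
    (h : ∀ z : ℂ, ‖z‖ < 1 → HasSum (fun n => a n * z ^ n) (A z)) (hr : 0 ≤ r) (hr1 : r < 1)
    (j : ℤ) :
    HasSum (fun n : ℕ => a n * (r : ℂ) ^ n * (Pi.single (n : ℤ) 1 : ℤ → ℂ) j)
      (fourierCoeff (fun t : Torus => A (r * (AddCircle.toCircle t : ℂ))) j) := by
  have key := hasSum_integral_of_summable_integral_norm
    (μ := (AddCircle.haarAddCircle : Measure Torus))
    (F := fun (n : ℕ) t => fourier (-j) t • (a n * (r : ℂ) ^ n * fourier (n : ℤ) t)) ?_ ?_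
  · convert! key using 1
    · funext n
      have := fourierCoeff.const_mul (T := 2 * Real.pi) (fourier (n : ℤ)) (a n * (r : ℂ) ^ n) j
      rw [fourierCoeff_fourier] at this
      rw [← this]; rfl
    · unfold fourierCoeff
      congr 1
      funext t
      simp only [smul_eq_mul]
      rw [tsum_mul_left]
      congr 1
      rw [← (h _ (by rwa [norm_real_mul_toCircle hr])).tsum_eq]
      refine tsum_congr fun n => ?_
      rw [fourier_natCast_apply, mul_pow, mul_assoc]
  · intro n
    refine Continuous.integrable_of_hasCompactSupport ?_ (HasCompactSupport.of_compactSpace _)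
    fun_prop
  · convert summable_norm_mul_pow h hr hr1 using 1
    funext n
    have : ∀ t : Torus, ‖fourier (-j) t • (a n * (r : ℂ) ^ n * fourier (n : ℤ) t)‖ =
        ‖a n‖ * r ^ n := by
      intro t
      rw [fourier_apply, fourier_apply, norm_smul, norm_mul, norm_mul, norm_pow, Circle.norm_coe,
        Circle.norm_coe]
      simp [abs_of_nonneg hr]
    simp_rw [this]
    simp

lemma fourierCoeff_comp_circle_natCast
    (h : ∀ z : ℂ, ‖z‖ < 1 → HasSum (fun n => a n * z ^ n) (A z)) (hr : 0 ≤ r) (hr1 : r < 1)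
    (n : ℕ) :
    fourierCoeff (fun t : Torus => A (r * (AddCircle.toCircle t : ℂ))) n = a n * (r : ℂ) ^ n := by
  refine (fourierCoeff_comp_circle h hr hr1 n).unique ?_
  convert hasSum_single (f := fun k : ℕ => a k * (r : ℂ) ^ k * (Pi.single (k : ℤ) 1 : ℤ → ℂ) n) n
    ?_ using 1
  · simp
  · intro k hk
    simp [Ne.symm hk]

lemma fourierCoeff_comp_circle_of_neg
    (h : ∀ z : ℂ, ‖z‖ < 1 → HasSum (fun n => a n * z ^ n) (A z)) (hr : 0 ≤ r) (hr1 : r < 1)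
    {j : ℤ} (hj : j < 0) :
    fourierCoeff (fun t : Torus => A (r * (AddCircle.toCircle t : ℂ))) j = 0 := by
  refine (fourierCoeff_comp_circle h hr hr1 j).unique ?_
  convert hasSum_zero using 1
  funext k
  rw [Pi.single_apply, if_neg (by lia), mul_zero]

/-- **Parseval's identity** on the circle of radius `r`. -/
lemma hasSum_sq_comp_circle (h : ∀ z : ℂ, ‖z‖ < 1 → HasSum (fun n => a n * z ^ n) (A z))
    (hr : 0 ≤ r) (hr1 : r < 1) :
    HasSum (fun n => ‖a n‖ ^ 2 * r ^ (2 * n))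
      (∫ t : Torus, ‖A (r * (AddCircle.toCircle t : ℂ))‖ ^ 2 ∂AddCircle.haarAddCircle) := by
  set Φ : C(Torus, ℂ) := ⟨_, continuous_comp_circle h hr hr1⟩
  have hP := hasSum_sq_fourierCoeff (ContinuousMap.toLp 2 AddCircle.haarAddCircle ℂ Φ)
  have hI : ∫ t, ‖(ContinuousMap.toLp 2 AddCircle.haarAddCircle ℂ Φ) t‖ ^ 2
      ∂AddCircle.haarAddCircle =
      ∫ t : Torus, ‖A (r * (AddCircle.toCircle t : ℂ))‖ ^ 2 ∂AddCircle.haarAddCircle := by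
    refine integral_congr_ae ?_
    filter_upwards [ContinuousMap.coeFn_toLp (p := 2) (𝕜 := ℂ) AddCircle.haarAddCircle Φ] with t ht
    rw [ht]; rfl
  rw [hI] at hP
  simp_rw [fourierCoeff_toLp] at hP
  have h2 := (Function.Injective.hasSum_iff (Nat.cast_injective (R := ℤ)) ?_).2 hP
  · convert h2 using 1
    funext n
    simp only [Function.comp]
    rw [show (⇑Φ) = fun t : Torus => A (r * (AddCircle.toCircle t : ℂ)) from rfl,
      fourierCoeff_comp_circle_natCast h hr hr1]
    simp [mul_pow, abs_of_nonneg hr, pow_mul']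
  · intro j hj
    have hj0 : j < 0 := by
      by_contra hc
      exact hj ⟨j.toNat, by simpa using hc⟩
    rw [show (⇑Φ) = fun t : Torus => A (r * (AddCircle.toCircle t : ℂ)) from rfl,
      fourierCoeff_comp_circle_of_neg h hr hr1 hj0]
    simp

/-- A coefficient of a power series is at most the `L¹` mean on the circles of radius `r → 1`. -/
lemma norm_coeff_le_of_integral_le
    (h : ∀ z : ℂ, ‖z‖ < 1 → HasSum (fun n => a n * z ^ n) (A z)) {C : ℝ}
    (hC : ∀ r : ℝ, 0 ≤ r → r < 1 →
      ∫ t : Torus, ‖A (r * (AddCircle.toCircle t : ℂ))‖ ∂AddCircle.haarAddCircle ≤ C) (n : ℕ) :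
    ‖a n‖ ≤ C := by
  have hle : ∀ᶠ r : ℝ in 𝓝[<] 1, ‖a n‖ * r ^ n ≤ C := by
    have : Set.Ioo (0 : ℝ) 1 ∈ 𝓝[<] (1 : ℝ) := Ioo_mem_nhdsLT one_pos
    filter_upwards [this] with r hr
    refine le_trans ?_ (hC r hr.1.le hr.2)
    have h1 : ‖a n‖ * r ^ n =
        ‖fourierCoeff (fun t : Torus => A (r * (AddCircle.toCircle t : ℂ))) n‖ := by
      rw [fourierCoeff_comp_circle_natCast h hr.1.le hr.2]
      simp [abs_of_nonneg hr.1.le]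
    rw [h1, fourierCoeff]
    refine (norm_integral_le_integral_norm _).trans (le_of_eq ?_)
    congr 1
    funext t
    rw [norm_smul, fourier_apply, Circle.norm_coe, one_mul]
  have ht : Tendsto (fun r : ℝ => ‖a n‖ * r ^ n) (𝓝[<] 1) (𝓝 (‖a n‖ * 1 ^ n)) :=
    ((continuous_const.mul (continuous_pow n)).tendsto 1).mono_left nhdsWithin_le_nhds
  simpa using le_of_tendsto ht hle

/-- The coefficients of a power series that is bounded in the disk are square summable, hence
tend to zero. -/
lemma tendsto_coeff_zero_of_bounded
    (h : ∀ z : ℂ, ‖z‖ < 1 → HasSum (fun n => a n * z ^ n) (A z)) {M : ℝ}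
    (hM : ∀ z : ℂ, ‖z‖ < 1 → ‖A z‖ ≤ M) : Tendsto a atTop (𝓝 0) := by
  have hs : Summable fun n => ‖a n‖ ^ 2 := by
    refine summable_of_sum_le (c := M ^ 2) (fun n => by positivity) fun s => ?_
    have ht : Tendsto (fun r : ℝ => ∑ n ∈ s, ‖a n‖ ^ 2 * r ^ (2 * n)) (𝓝[<] 1)
        (𝓝 (∑ n ∈ s, ‖a n‖ ^ 2 * 1 ^ (2 * n))) := by
      refine Tendsto.mono_left (Continuous.tendsto ?_ 1) nhdsWithin_le_nhds
      fun_prop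
    simp only [one_pow, mul_one] at ht
    refine le_of_tendsto ht ?_
    have : Set.Ioo (0 : ℝ) 1 ∈ 𝓝[<] (1 : ℝ) := Ioo_mem_nhdsLT one_pos
    filter_upwards [this] with r hr
    have hP := hasSum_sq_comp_circle h hr.1.le hr.2
    refine (sum_le_hasSum s (fun n _ => by have := hr.1; positivity) hP).trans ?_
    refine (integral_mono_of_nonneg (ae_of_all _ fun t => by positivity)
      (integrable_const (M ^ 2)) (ae_of_all _ fun t => ?_)).trans (by simp)
    have := hM (r * (AddCircle.toCircle t : ℂ)) (by rw [norm_real_mul_toCircle hr.1.le]; exact hr.2)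
    exact pow_le_pow_left₀ (norm_nonneg _) this 2
  have h0 := hs.tendsto_atTop_zero
  rw [tendsto_zero_iff_norm_tendsto_zero]
  have := h0.sqrt
  simpa [Real.sqrt_sq] using this

/-- Pointwise bounded convergence of power series on one circle yields convergence of each
coefficient. -/
lemma tendsto_coeff_of_tendsto {b : ℕ → ℕ → ℂ} {B : ℕ → ℂ → ℂ}
    (h : ∀ z : ℂ, ‖z‖ < 1 → HasSum (fun n => a n * z ^ n) (A z))
    (hb : ∀ k, ∀ z : ℂ, ‖z‖ < 1 → HasSum (fun n => b k n * z ^ n) (B k z))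
    (hr : 0 < r) (hr1 : r < 1) {M : ℝ} (hM : ∀ k, ∀ z : ℂ, ‖z‖ = r → ‖B k z‖ ≤ M)
    (hlim : ∀ z : ℂ, ‖z‖ = r → Tendsto (fun k => B k z) atTop (𝓝 (A z))) (n : ℕ) :
    Tendsto (fun k => b k n) atTop (𝓝 (a n)) := by
  have key : Tendsto (fun k => b k n * (r : ℂ) ^ n) atTop (𝓝 (a n * (r : ℂ) ^ n)) := by
    rw [← fourierCoeff_comp_circle_natCast h hr.le hr1]
    simp_rw [← fun k => fourierCoeff_comp_circle_natCast (hb k) hr.le hr1 n]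
    refine tendsto_integral_of_dominated_convergence (fun _ => M) (fun k => ?_)
      (integrable_const M) (fun k => ae_of_all _ fun t => ?_) (ae_of_all _ fun t => ?_)
    · exact (((fourier (-(n : ℤ))).continuous.smul
        (continuous_comp_circle (hb k) hr.le hr1))).aestronglyMeasurable
    · rw [norm_smul, fourier_apply, Circle.norm_coe, one_mul]
      exact hM k _ (norm_real_mul_toCircle hr.le t)
    · exact (hlim _ (norm_real_mul_toCircle hr.le t)).const_smul _
  have hrn : (r : ℂ) ^ n ≠ 0 := by
    have : (r : ℂ) ≠ 0 := by exact_mod_cast hr.ne'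
    positivity
  have := key.div_const ((r : ℂ) ^ n)
  simpa [mul_div_assoc, div_self hrn] using this

end PowerSeries

/-! ### The Herglotz kernel -/

/-- The Herglotz kernel `(e^{it} + z) / (e^{it} - z)`. -/
noncomputable def herglotzKernel (z : ℂ) (t : Torus) : ℂ :=
  ((AddCircle.toCircle t : ℂ) + z) / ((AddCircle.toCircle t : ℂ) - z)

lemma toCircle_sub_ne_zero {z : ℂ} (hz : ‖z‖ < 1) (t : Torus) :
    (AddCircle.toCircle t : ℂ) - z ≠ 0 := by
  intro h
  rw [← sub_eq_zero.1 h, Circle.norm_coe] at hz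
  exact lt_irrefl _ hz

lemma one_sub_norm_le_norm_toCircle_sub (z : ℂ) (t : Torus) :
    1 - ‖z‖ ≤ ‖(AddCircle.toCircle t : ℂ) - z‖ := by
  simpa [Circle.norm_coe] using norm_sub_norm_le (AddCircle.toCircle t : ℂ) z

lemma continuous_toCircle_coe : Continuous fun t : Torus => (AddCircle.toCircle t : ℂ) :=
  continuous_induced_dom.comp AddCircle.continuous_toCircle

lemma measurable_herglotzKernel (z : ℂ) : Measurable (herglotzKernel z) :=
  (continuous_toCircle_coe.add continuous_const).measurable.div
    (continuous_toCircle_coe.sub continuous_const).measurable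

lemma continuous_herglotzKernel {z : ℂ} (hz : ‖z‖ < 1) : Continuous (herglotzKernel z) :=
  (continuous_toCircle_coe.add continuous_const).div
    (continuous_toCircle_coe.sub continuous_const) (toCircle_sub_ne_zero hz)

lemma norm_herglotzKernel_le {z : ℂ} (hz : ‖z‖ < 1) (t : Torus) :
    ‖herglotzKernel z t‖ ≤ (1 + ‖z‖) / (1 - ‖z‖) := by
  rw [herglotzKernel, norm_div]
  have h1 : ‖(AddCircle.toCircle t : ℂ) + z‖ ≤ 1 + ‖z‖ := by
    simpa [Circle.norm_coe] using norm_add_le (AddCircle.toCircle t : ℂ) z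
  exact div_le_div₀ (by positivity) h1 (by linarith) (one_sub_norm_le_norm_toCircle_sub z t)

lemma re_herglotzKernel (z : ℂ) (t : Torus) :
    (herglotzKernel z t).re = (1 - ‖z‖ ^ 2) / ‖(AddCircle.toCircle t : ℂ) - z‖ ^ 2 := by
  have h1 : Complex.normSq (AddCircle.toCircle t : ℂ) = 1 := by
    rw [Complex.normSq_eq_norm_sq, Circle.norm_coe, one_pow]
  rw [herglotzKernel, Complex.div_re, ← Complex.normSq_eq_norm_sq, ← Complex.normSq_eq_norm_sq,
    ← add_div]
  congr 1
  rw [← h1, Complex.normSq_apply, Complex.normSq_apply]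
  simp only [Complex.add_re, Complex.sub_re, Complex.add_im, Complex.sub_im]
  ring

lemma re_herglotzKernel_nonneg {z : ℂ} (hz : ‖z‖ ≤ 1) (t : Torus) :
    0 ≤ (herglotzKernel z t).re := by
  rw [re_herglotzKernel]
  have : ‖z‖ ^ 2 ≤ 1 := pow_le_one₀ (norm_nonneg _) hz
  exact div_nonneg (by linarith) (by positivity)

lemma hasSum_herglotzKernel {z : ℂ} (hz : ‖z‖ < 1) (t : Torus) :
    HasSum (fun n : ℕ => (if n = 0 then 1 else 2) * (fourier (-(n : ℤ)) t * z ^ n))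
      (herglotzKernel z t) := by
  set e : ℂ := (AddCircle.toCircle t : ℂ) with he
  have he0 : e ≠ 0 := Circle.coe_ne_zero _
  have hne : e - z ≠ 0 := toCircle_sub_ne_zero hz t
  have hx : ‖z / e‖ < 1 := by rwa [norm_div, he, Circle.norm_coe, div_one]
  have h1 := (hasSum_geometric_of_norm_lt_one hx).mul_left 2
  have h2 := h1.sub (hasSum_ite_eq (0 : ℕ) (1 : ℂ))
  convert! h2 using 1
  · funext n
    rw [fourier_neg, fourier_natCast_apply, ← he, map_pow, ← Circle.coe_inv_eq_conj,
      Circle.coe_inv, ← he, ← mul_pow, inv_mul_eq_div]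
    rcases eq_or_ne n 0 with rfl | hn
    · norm_num
    · simp [hn]
  · rw [herglotzKernel, ← he]
    have : 1 - z / e ≠ 0 := by
      rw [one_sub_div he0]; exact div_ne_zero hne he0
    field_simp
    ring

/-! ### Herglotz transforms of functions -/

/-- The Herglotz transform `∫ g(t) (e^{it} + z) / (e^{it} - z) dt / 2π` of a function `g`. -/
noncomputable def herglotzFun (g : Torus → ℂ) (z : ℂ) : ℂ :=
  ∫ t, g t * herglotzKernel z t ∂AddCircle.haarAddCircle

lemma hasSum_herglotzFun {g : Torus → ℂ} (hg : Integrable g AddCircle.haarAddCircle) (z : ℂ)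
    (hz : ‖z‖ < 1) :
    HasSum (fun n : ℕ => (if n = 0 then 1 else 2) * fourierCoeff g n * z ^ n)
      (herglotzFun g z) := by
  have key := hasSum_integral_of_summable_integral_norm
    (μ := (AddCircle.haarAddCircle : Measure Torus))
    (F := fun (n : ℕ) t => (if n = 0 then 1 else 2) * z ^ n * (fourier (-(n : ℤ)) t • g t)) ?_ ?_
  · convert! key using 1
    · funext n
      rw [integral_const_mul, fourierCoeff]
      ring
    · unfold herglotzFun
      congr 1
      funext t
      rw [← (hasSum_herglotzKernel hz t).tsum_eq, ← tsum_mul_left]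
      refine tsum_congr fun n => ?_
      rw [smul_eq_mul]
      ring
  · intro n
    exact (hg.fourier_smul _).const_mul _
  · have hs : Summable fun n : ℕ => 2 * ‖z‖ ^ n * ∫ t, ‖g t‖ ∂AddCircle.haarAddCircle :=
      ((summable_geometric_of_lt_one (norm_nonneg _) hz).mul_left 2).mul_right _
    refine Summable.of_nonneg_of_le (fun n => integral_nonneg fun t => norm_nonneg _)
      (fun n => ?_) hs
    rw [← integral_const_mul]
    refine integral_mono ((hg.fourier_smul _).const_mul _).norm (hg.norm.const_mul _) fun t => ?_
    simp only [norm_mul, norm_smul, norm_pow]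
    rw [fourier_apply, Circle.norm_coe, one_mul]
    gcongr
    split_ifs <;> norm_num

/-- The Herglotz transform is bounded from `L²` to `L²` of every smaller circle. -/
lemma integral_norm_sq_herglotzFun_le {g : Torus → ℂ} (hg : MemLp g 2 AddCircle.haarAddCircle)
    {r : ℝ} (hr : 0 ≤ r) (hr1 : r < 1) :
    ∫ t : Torus, ‖herglotzFun g (r * (AddCircle.toCircle t : ℂ))‖ ^ 2 ∂AddCircle.haarAddCircle ≤
      4 * ∫ t, ‖g t‖ ^ 2 ∂AddCircle.haarAddCircle := by
  have hP := hasSum_sq_comp_circle (hasSum_herglotzFun (hg.integrable (by norm_num))) hr hr1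
  have hB := hasSum_sq_fourierCoeff (hg.toLp g)
  have hc : fourierCoeff (hg.toLp g) = fourierCoeff g :=
    fourierCoeff_congr_ae hg.coeFn_toLp
  have hI : ∫ t, ‖(hg.toLp g) t‖ ^ 2 ∂AddCircle.haarAddCircle =
      ∫ t, ‖g t‖ ^ 2 ∂AddCircle.haarAddCircle := by
    refine integral_congr_ae ?_
    filter_upwards [hg.coeFn_toLp] with t ht
    rw [ht]
  rw [hI, hc] at hB
  have hB' := hB.summable.comp_injective (Nat.cast_injective (R := ℤ))
  rw [← hP.tsum_eq]
  calc _ ≤ ∑' n : ℕ, 4 * ‖fourierCoeff g (n : ℤ)‖ ^ 2 := by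
        refine hP.summable.tsum_le_tsum (fun n => ?_) (hB'.mul_left 4)
        have h1 : r ^ (2 * n) ≤ 1 := pow_le_one₀ hr hr1.le
        have h2 : ‖(if n = 0 then 1 else 2 : ℂ)‖ ^ 2 ≤ 4 := by split_ifs <;> norm_num
        rw [norm_mul, mul_pow]
        calc _ ≤ 4 * ‖fourierCoeff g (n : ℤ)‖ ^ 2 * 1 := by gcongr
          _ = _ := mul_one _
    _ = 4 * ∑' n : ℕ, ‖fourierCoeff g (n : ℤ)‖ ^ 2 := tsum_mul_left
    _ ≤ 4 * ∑' n : ℤ, ‖fourierCoeff g n‖ ^ 2 := by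
        gcongr
        exact tsum_comp_le_tsum_of_inj hB.summable (fun n => by positivity)
          (Nat.cast_injective (R := ℤ))
    _ = _ := by rw [hB.tsum_eq]

/-! ### Herglotz transforms of measures -/

/-- The Herglotz transform `∫ (e^{it} + z) / (e^{it} - z) dμ(t)` of a measure `μ`. -/
noncomputable def herglotz (μ : Measure Torus) (z : ℂ) : ℂ :=
  ∫ t, herglotzKernel z t ∂μ

lemma integrable_herglotzKernel {μ : Measure Torus} [IsFiniteMeasure μ] {z : ℂ} (hz : ‖z‖ < 1) :
    Integrable (herglotzKernel z) μ :=
  (continuous_herglotzKernel hz).integrable_of_hasCompactSupport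
    (HasCompactSupport.of_compactSpace _)

lemma herglotz_zero_apply (μ : Measure Torus) [IsFiniteMeasure μ] :
    herglotz μ 0 = (μ.real Set.univ : ℂ) := by
  have : ∀ t : Torus, herglotzKernel 0 t = 1 := fun t => by
    rw [herglotzKernel, add_zero, sub_zero, div_self (Circle.coe_ne_zero _)]
  simp [herglotz, this]

lemma herglotz_haar {z : ℂ} (hz : ‖z‖ < 1) :
    herglotz (AddCircle.haarAddCircle : Measure Torus) z = 1 := by
  have h := hasSum_herglotzFun (g := fourier 0)
    ((fourier 0).continuous.integrable_of_hasCompactSupport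
      (HasCompactSupport.of_compactSpace _)) z hz
  rw [fourierCoeff_fourier] at h
  have h1 : herglotz (AddCircle.haarAddCircle : Measure Torus) z = herglotzFun (fourier 0) z := by
    simp only [herglotz, herglotzFun, fourier_zero, one_mul]
  rw [h1]
  refine h.unique ?_
  convert hasSum_ite_eq (0 : ℕ) (1 : ℂ) using 1
  funext n
  rcases eq_or_ne n 0 with rfl | hn
  · simp
  · simp [hn]

lemma re_herglotz {μ : Measure Torus} [IsFiniteMeasure μ] {z : ℂ} (hz : ‖z‖ < 1) :
    (herglotz μ z).re = ∫ t, (herglotzKernel z t).re ∂μ :=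
  (integral_re (integrable_herglotzKernel hz)).symm

lemma norm_herglotz_le (μ : Measure Torus) [IsFiniteMeasure μ] {z : ℂ} (hz : ‖z‖ < 1) :
    ‖herglotz μ z‖ ≤ (1 + ‖z‖) / (1 - ‖z‖) * μ.real Set.univ :=
  norm_integral_le_of_norm_le_const (ae_of_all _ (norm_herglotzKernel_le hz))

/-- The Herglotz transform of a finite measure is complex differentiable away from the closure
of `{e^{it} : t ∈ supp μ}`. -/
lemma differentiableAt_herglotz (μ : Measure Torus) [IsFiniteMeasure μ] {z₀ : ℂ} {δ : ℝ}
    (hδ : 0 < δ) (h : ∀ᵐ t ∂μ, δ ≤ ‖(AddCircle.toCircle t : ℂ) - z₀‖) :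
    DifferentiableAt ℂ (herglotz μ) z₀ := by
  have hmem : Metric.ball z₀ (δ / 2) ∈ 𝓝 z₀ := Metric.ball_mem_nhds _ (by positivity)
  have hfar : ∀ᵐ t ∂μ, ∀ z ∈ Metric.ball z₀ (δ / 2),
      δ / 2 ≤ ‖(AddCircle.toCircle t : ℂ) - z‖ := by
    filter_upwards [h] with t ht z hz
    rw [Metric.mem_ball, dist_eq_norm] at hz
    have : ‖(AddCircle.toCircle t : ℂ) - z₀‖ ≤ ‖(AddCircle.toCircle t : ℂ) - z‖ + ‖z - z₀‖ := by
      simpa using norm_add_le ((AddCircle.toCircle t : ℂ) - z) (z - z₀)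
    linarith
  refine (hasDerivAt_integral_of_dominated_loc_of_deriv_le (μ := μ) (F := herglotzKernel)
    (F' := fun z t => 2 * (AddCircle.toCircle t : ℂ) / ((AddCircle.toCircle t : ℂ) - z) ^ 2)
    (bound := fun _ => 2 / (δ / 2) ^ 2) hmem ?_ ?_ ?_ ?_ (integrable_const _) ?_).2.differentiableAt
  · exact Eventually.of_forall fun z => (measurable_herglotzKernel z).aestronglyMeasurable
  · refine Integrable.of_bound (measurable_herglotzKernel z₀).aestronglyMeasurable
      ((1 + ‖z₀‖) / δ) ?_
    filter_upwards [h] with t ht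
    rw [herglotzKernel, norm_div]
    have h1 : ‖(AddCircle.toCircle t : ℂ) + z₀‖ ≤ 1 + ‖z₀‖ := by
      simpa [Circle.norm_coe] using norm_add_le (AddCircle.toCircle t : ℂ) z₀
    exact div_le_div₀ (by positivity) h1 hδ ht
  · exact ((continuous_const.mul continuous_toCircle_coe).measurable.div
      ((continuous_toCircle_coe.sub continuous_const).pow 2).measurable).aestronglyMeasurable
  · filter_upwards [hfar] with t ht z hz
    rw [norm_div, norm_mul, norm_pow, Circle.norm_coe, mul_one, Complex.norm_ofNat]
    have := ht z hz
    gcongr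
  · filter_upwards [hfar] with t ht z hz
    have hne : (AddCircle.toCircle t : ℂ) - z ≠ 0 := by
      rw [← norm_pos_iff]; linarith [ht z hz]
    have := ((hasDerivAt_id z).const_add (AddCircle.toCircle t : ℂ)).div
      ((hasDerivAt_id z).const_sub (AddCircle.toCircle t : ℂ)) hne
    convert! this using 1
    simp only [id]
    congr 1
    ring

lemma differentiableOn_herglotz (μ : Measure Torus) [IsFiniteMeasure μ] :
    DifferentiableOn ℂ (herglotz μ) (Metric.ball 0 1) := fun z hz => by
  refine (differentiableAt_herglotz μ (δ := 1 - ‖z‖) ?_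
    (ae_of_all _ (one_sub_norm_le_norm_toCircle_sub z))).differentiableWithinAt
  simpa using hz

/-! ### Exponentials of Herglotz transforms and their Taylor coefficients -/

/-- The `n`-th Taylor coefficient at the origin. -/
noncomputable def taylorCoeff (F : ℂ → ℂ) (n : ℕ) : ℂ :=
  (n.factorial : ℂ)⁻¹ * iteratedDeriv n F 0

lemma hasSum_taylorCoeff {F : ℂ → ℂ} (hF : DifferentiableOn ℂ F (Metric.ball 0 1)) (z : ℂ)
    (hz : ‖z‖ < 1) : HasSum (fun n => taylorCoeff F n * z ^ n) (F z) := by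
  convert! Complex.hasSum_taylorSeries_on_ball hF (z := z) (by simpa using hz) using 1
  funext n
  simp only [taylorCoeff, sub_zero, smul_eq_mul]
  ring

/-- The zero free analytic function `exp (∫ (e^{it} + z) / (e^{it} - z) dμ(t))`. -/
noncomputable def expHerglotz (μ : Measure Torus) (z : ℂ) : ℂ :=
  Complex.exp (herglotz μ z)

lemma differentiableOn_expHerglotz (μ : Measure Torus) [IsFiniteMeasure μ] :
    DifferentiableOn ℂ (expHerglotz μ) (Metric.ball 0 1) :=
  (differentiableOn_herglotz μ).cexp

lemma hasSum_expHerglotz (μ : Measure Torus) [IsFiniteMeasure μ] (z : ℂ) (hz : ‖z‖ < 1) :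
    HasSum (fun n => taylorCoeff (expHerglotz μ) n * z ^ n) (expHerglotz μ z) :=
  hasSum_taylorCoeff (differentiableOn_expHerglotz μ) z hz

lemma taylorCoeff_zero (F : ℂ → ℂ) : taylorCoeff F 0 = F 0 := by
  simp [taylorCoeff]

lemma norm_exp_sub_exp_le {a b : ℂ} {R : ℝ} (ha : a.re ≤ R) (hb : b.re ≤ R) :
    ‖Complex.exp a - Complex.exp b‖ ≤ Real.exp R * ‖a - b‖ := by
  refine Convex.norm_image_sub_le_of_norm_deriv_le (s := {z : ℂ | z.re ≤ R})
    (fun z _ => Complex.differentiableAt_exp) (fun z hz => ?_) (convex_halfSpace_re_le R) hb ha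
  rw [Complex.deriv_exp, Complex.norm_exp]
  exact Real.exp_le_exp.2 hz

/-! ### Mean values of rapidly oscillating functions -/

lemma measurePreserving_nsmul_torus {N : ℕ} (hN : N ≠ 0) :
    MeasurePreserving (fun t : Torus => N • t) AddCircle.haarAddCircle AddCircle.haarAddCircle := by
  simpa using Measure.measurePreserving_zsmul (AddCircle.haarAddCircle : Measure Torus)
    (n := (N : ℤ)) (by exact_mod_cast hN)

lemma integral_comp_nsmul {E : Type*} [NormedAddCommGroup E] [NormedSpace ℝ E] {w : Torus → E}
    (hw : StronglyMeasurable w) {N : ℕ} (hN : N ≠ 0) :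
    ∫ t, w (N • t) ∂AddCircle.haarAddCircle = ∫ t, w t ∂AddCircle.haarAddCircle := by
  have h := measurePreserving_nsmul_torus hN
  rw [← integral_map h.measurable.aemeasurable hw.aestronglyMeasurable, h.map_eq]

/-- If `0 < |j| < N`, then `t ↦ w (N t)` is orthogonal to `e^{ijt}`: translation by `2π / N`
preserves the integral and multiplies it by a number different from `1`. -/
lemma integral_fourier_mul_comp_nsmul_eq_zero (w : Torus → ℂ) {N : ℕ} {j : ℤ} (hj : j ≠ 0)
    (hN : j.natAbs < N) :
    ∫ t, fourier j t * w (N • t) ∂AddCircle.haarAddCircle = 0 := by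
  have hN0 : 0 < N := by lia
  set s : Torus := ((2 * Real.pi / N : ℝ) : Torus) with hs
  have hord : addOrderOf s = N := AddCircle.addOrderOf_period_div (p := 2 * Real.pi) hN0
  have hNs : N • s = 0 := by rw [← hord]; exact addOrderOf_nsmul_eq_zero s
  have hjs : fourier j s ≠ 1 := by
    intro h
    have h1 : AddCircle.toCircle (j • s) = AddCircle.toCircle (0 : Torus) := by
      rw [AddCircle.toCircle_zero, ← Circle.coe_inj, Circle.coe_one, ← fourier_apply, h]
    have h2 : j • s = 0 := AddCircle.injective_toCircle Real.two_pi_pos.ne' h1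
    rw [← addOrderOf_dvd_iff_zsmul_eq_zero, hord] at h2
    have := Int.natAbs_le_of_dvd_ne_zero h2 hj
    simp only [Int.natAbs_natCast] at this
    lia
  have hinv := integral_add_right_eq_self (μ := (AddCircle.haarAddCircle : Measure Torus))
    (fun t => fourier j t * w (N • t)) s
  have h3 : ∀ t : Torus, fourier j (t + s) * w (N • (t + s)) =
      fourier j s * (fourier j t * w (N • t)) := by
    intro t
    rw [smul_add, hNs, add_zero, fourier_apply, smul_add, AddCircle.toCircle_add, Circle.coe_mul,
      fourier_apply, fourier_apply]
    ring
  simp_rw [h3] at hinv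
  rw [integral_const_mul] at hinv
  have h4 : (fourier j s - 1) * ∫ t, fourier j t * w (N • t) ∂AddCircle.haarAddCircle = 0 := by
    rw [sub_mul, hinv, one_mul, sub_self]
  exact (mul_eq_zero.1 h4).resolve_left (sub_ne_zero.2 hjs)

lemma integrable_mul_comp_nsmul {g w : Torus → ℂ} (hg : Integrable g AddCircle.haarAddCircle)
    (hw : Measurable w) {C : ℝ} (hC : ∀ t, ‖w t‖ ≤ C) (N : ℕ) :
    Integrable (fun t => g t * w (N • t)) AddCircle.haarAddCircle :=
  hg.mul_bdd (c := C) (hw.comp (by fun_prop)).aestronglyMeasurable (ae_of_all _ fun t => hC _)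

/-- **Fejér's lemma**: `∫ g(t) w(Nt) → ∫ g · ∫ w` for integrable `g` and bounded `w`. -/
lemma tendsto_integral_mul_comp_nsmul {g w : Torus → ℂ}
    (hg : Integrable g AddCircle.haarAddCircle) (hw : Measurable w) {C : ℝ}
    (hC : ∀ t, ‖w t‖ ≤ C) :
    Tendsto (fun N : ℕ => ∫ t, g t * w (N • t) ∂AddCircle.haarAddCircle) atTop
      (𝓝 ((∫ t, g t ∂AddCircle.haarAddCircle) * ∫ t, w t ∂AddCircle.haarAddCircle)) := by
  set m : Measure Torus := AddCircle.haarAddCircle with hm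
  have hC0 : 0 ≤ C := (norm_nonneg _).trans (hC 0)
  have hspan : ∀ p ∈ Submodule.span ℂ (Set.range (fourierLp (T := 2 * Real.pi) 1)),
      Tendsto (fun N : ℕ => ∫ t, p t * w (N • t) ∂m) atTop
        (𝓝 ((∫ t, p t ∂m) * ∫ t, w t ∂m)) := by
    intro p hp
    induction hp using Submodule.span_induction with
    | mem p hp =>
      obtain ⟨j, rfl⟩ := hp
      have hae := coeFn_fourierLp (T := 2 * Real.pi) 1 j
      have h1 : ∀ N : ℕ, ∫ t, fourierLp (T := 2 * Real.pi) 1 j t * w (N • t) ∂m =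
          ∫ t, fourier j t * w (N • t) ∂m := fun N => by
        refine integral_congr_ae ?_
        filter_upwards [hae] with t ht
        rw [ht]
      have h2 : ∫ t, fourierLp (T := 2 * Real.pi) 1 j t ∂m = ∫ t, fourier j t ∂m :=
        integral_congr_ae hae
      simp_rw [h1, h2]
      refine tendsto_const_nhds.congr' ?_
      filter_upwards [eventually_gt_atTop j.natAbs] with N hN
      rcases eq_or_ne j 0 with rfl | hj
      · simp only [fourier_zero, one_mul]
        rw [integral_comp_nsmul hw.stronglyMeasurable (by lia)]
        simp [m]
      · have h3 := integral_fourier_mul_comp_nsmul_eq_zero (fun _ => 1) hj hN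
        simp only [mul_one] at h3
        rw [integral_fourier_mul_comp_nsmul_eq_zero w hj hN, h3, zero_mul]
    | zero =>
      have hae := Lp.coeFn_zero ℂ 1 m
      have h1 : ∀ N : ℕ, ∫ t, (0 : Lp ℂ 1 m) t * w (N • t) ∂m = 0 := fun N => by
        refine integral_eq_zero_of_ae ?_
        filter_upwards [hae] with t ht
        rw [ht, Pi.zero_apply, zero_mul]
      have h2 : ∫ t, (0 : Lp ℂ 1 m) t ∂m = 0 := integral_eq_zero_of_ae hae
      simp_rw [h1, h2, zero_mul]
      exact tendsto_const_nhds
    | add p q _ _ hp hq =>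
      have hae := Lp.coeFn_add p q
      have hpi := L1.integrable_coeFn p
      have hqi := L1.integrable_coeFn q
      have h1 : ∀ N : ℕ, ∫ t, (p + q) t * w (N • t) ∂m =
          (∫ t, p t * w (N • t) ∂m) + ∫ t, q t * w (N • t) ∂m := fun N => by
        rw [← integral_add (integrable_mul_comp_nsmul hpi hw hC N)
          (integrable_mul_comp_nsmul hqi hw hC N)]
        refine integral_congr_ae ?_
        filter_upwards [hae] with t ht
        rw [ht, Pi.add_apply, add_mul]
      have h2 : ∫ t, (p + q) t ∂m = (∫ t, p t ∂m) + ∫ t, q t ∂m := by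
        rw [← integral_add hpi hqi]
        exact integral_congr_ae hae
      simp_rw [h1, h2, add_mul]
      exact hp.add hq
    | smul c p _ hp =>
      have hae := Lp.coeFn_smul c p
      have h1 : ∀ N : ℕ, ∫ t, (c • p) t * w (N • t) ∂m = c * ∫ t, p t * w (N • t) ∂m := fun N => by
        rw [← integral_const_mul]
        refine integral_congr_ae ?_
        filter_upwards [hae] with t ht
        rw [ht, Pi.smul_apply, smul_eq_mul, mul_assoc]
      have h2 : ∫ t, (c • p) t ∂m = c * ∫ t, p t ∂m := by
        rw [← integral_const_mul]
        exact integral_congr_ae hae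
      simp_rw [h1, h2, mul_assoc]
      exact hp.const_mul c
  have hmem : hg.toL1 g ∈
      closure (Submodule.span ℂ (Set.range (fourierLp (T := 2 * Real.pi) 1)) : Set (Lp ℂ 1 m)) := by
    rw [← Submodule.topologicalClosure_coe, span_fourierLp_closure_eq_top (by simp)]
    trivial
  rw [Metric.tendsto_atTop]
  intro ε hε
  obtain ⟨p, hp, hgp⟩ := Metric.mem_closure_iff.1 hmem (ε / (3 * (C + 1))) (by positivity)
  have hpi := L1.integrable_coeFn p
  have hd : ∫ t, ‖g t - p t‖ ∂m < ε / (3 * (C + 1)) := by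
    rw [dist_eq_norm, L1.norm_eq_integral_norm] at hgp
    refine lt_of_eq_of_lt (integral_congr_ae ?_) hgp
    filter_upwards [Lp.coeFn_sub (hg.toL1 g) p, hg.coeFn_toL1] with t h1 h2
    rw [h1, Pi.sub_apply, h2]
  have hbound : ∀ v : Torus → ℂ, Measurable v → (∀ t, ‖v t‖ ≤ C) →
      ‖(∫ t, g t * v t ∂m) - ∫ t, p t * v t ∂m‖ ≤ ε / 3 := by
    intro v hv hvC
    have i1 : Integrable (fun t => g t * v t) m :=
      hg.mul_bdd (c := C) hv.aestronglyMeasurable (ae_of_all _ hvC)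
    have i2 : Integrable (fun t => p t * v t) m :=
      hpi.mul_bdd (c := C) hv.aestronglyMeasurable (ae_of_all _ hvC)
    rw [← integral_sub i1 i2]
    calc _ ≤ ∫ t, ‖g t * v t - p t * v t‖ ∂m := norm_integral_le_integral_norm _
      _ ≤ ∫ t, ‖g t - p t‖ * C ∂m := by
        refine integral_mono (i1.sub i2).norm ((hg.sub hpi).norm.mul_const C) fun t => ?_
        simp only [← sub_mul, norm_mul]
        exact mul_le_mul_of_nonneg_left (hvC t) (norm_nonneg _)
      _ = (∫ t, ‖g t - p t‖ ∂m) * C := integral_mul_const _ _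
      _ ≤ ε / (3 * (C + 1)) * (C + 1) := by
        refine mul_le_mul hd.le (by linarith) hC0 (by positivity)
      _ = ε / 3 := by field_simp
  obtain ⟨N₀, hN₀⟩ := Metric.tendsto_atTop.1 (hspan p hp) (ε / 3) (by positivity)
  refine ⟨N₀, fun N hN => ?_⟩
  have h1 := hN₀ N hN
  have h2 := hbound (fun t => w (N • t)) (hw.comp (by fun_prop)) fun t => hC _
  have h3 := hbound (fun _ => ∫ t, w t ∂m) measurable_const fun _ => by
    simpa using norm_integral_le_of_norm_le_const (μ := m) (ae_of_all _ hC)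
  rw [integral_mul_const, integral_mul_const] at h3
  rw [dist_eq_norm] at h1 ⊢
  rw [norm_sub_rev] at h3
  have h4 := norm_add₃_le
    (a := (∫ t, g t * w (N • t) ∂m) - ∫ t, p t * w (N • t) ∂m)
    (b := (∫ t, p t * w (N • t) ∂m) - (∫ t, p t ∂m) * ∫ t, w t ∂m)
    (c := (∫ t, p t ∂m) * (∫ t, w t ∂m) - (∫ t, g t ∂m) * ∫ t, w t ∂m)
  rw [sub_add_sub_cancel, sub_add_sub_cancel] at h4
  linarith

/-! ### One step of the construction -/

/-- The measure with constant density `R` with respect to `haarAddCircle` on the set `E`. -/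
noncomputable def blockMeasure (R : ℝ) (E : Set Torus) : Measure Torus :=
  ENNReal.ofReal R • (AddCircle.haarAddCircle : Measure Torus).restrict E

instance (R : ℝ) (E : Set Torus) : IsFiniteMeasure (blockMeasure R E) := by
  unfold blockMeasure
  exact Measure.smul_finite _ ENNReal.ofReal_ne_top

lemma herglotz_blockMeasure {R : ℝ} (hR : 0 ≤ R) {E : Set Torus} (hE : MeasurableSet E) (z : ℂ) :
    herglotz (blockMeasure R E) z = herglotzFun (E.indicator fun _ => (R : ℂ)) z := by
  rw [herglotz, blockMeasure, integral_smul_measure, ENNReal.toReal_ofReal hR, herglotzFun,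
    ← integral_indicator hE, ← integral_smul]
  congr 1
  funext t
  by_cases ht : t ∈ E <;> simp [ht]

/-- The Poisson integral of a density bounded by `R` is bounded by `R`. -/
lemma re_herglotz_blockMeasure_le {R : ℝ} (hR : 0 ≤ R) (E : Set Torus) {z : ℂ} (hz : ‖z‖ < 1) :
    (herglotz (blockMeasure R E) z).re ≤ R := by
  set ν : Measure Torus := ENNReal.ofReal R • (AddCircle.haarAddCircle : Measure Torus) with hν
  have : IsFiniteMeasure ν := Measure.smul_finite _ ENNReal.ofReal_ne_top
  have h1 : (herglotz ν z).re = R := by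
    have : herglotz ν z = R • herglotz (AddCircle.haarAddCircle : Measure Torus) z := by
      rw [herglotz, hν, integral_smul_measure, ENNReal.toReal_ofReal hR, herglotz]
    rw [this, herglotz_haar hz]
    simp
  have hle : blockMeasure R E ≤ ν :=
    fun s => by
      rw [blockMeasure, hν, Measure.smul_apply, Measure.smul_apply]
      exact mul_le_mul_right (Measure.restrict_le_self s) _
  refine le_of_le_of_eq ?_ h1
  rw [re_herglotz hz, re_herglotz hz]
  refine integral_mono_measure hle (ae_of_all _ fun t => re_herglotzKernel_nonneg hz.le t) ?_
  exact (integrable_herglotzKernel hz).re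

lemma norm_expHerglotz_blockMeasure_le {R : ℝ} (hR : 0 ≤ R) (E : Set Torus) {z : ℂ}
    (hz : ‖z‖ < 1) : ‖expHerglotz (blockMeasure R E) z‖ ≤ Real.exp R := by
  rw [expHerglotz, Complex.norm_exp]
  exact Real.exp_le_exp.2 (re_herglotz_blockMeasure_le hR E hz)

lemma exists_isClosed_haar_eq {θ : ℝ} (h0 : 0 ≤ θ) (h1 : θ ≤ 1) :
    ∃ A : Set Torus, IsClosed A ∧ (AddCircle.haarAddCircle : Measure Torus).real A = θ := by
  refine ⟨Metric.closedBall 0 (Real.pi * θ), Metric.isClosed_closedBall, ?_⟩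
  have hpi := Real.pi_pos
  have hv := AddCircle.volume_closedBall (2 * Real.pi) (x := 0) (Real.pi * θ)
  rw [min_eq_right (by nlinarith), AddCircle.volume_eq_smul_haarAddCircle, Measure.smul_apply,
    smul_eq_mul] at hv
  have := congrArg ENNReal.toReal hv
  rw [ENNReal.toReal_mul, ENNReal.toReal_ofReal (by positivity),
    ENNReal.toReal_ofReal (by positivity)] at this
  rw [measureReal_def]
  have h2 : (2 * Real.pi) ≠ 0 := by positivity
  apply mul_left_cancel₀ h2
  linarith

lemma integral_norm_le_sqrt_integral_sq {f : Torus → ℂ} (hf : Continuous f) :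
    ∫ t, ‖f t‖ ∂AddCircle.haarAddCircle ≤ √(∫ t, ‖f t‖ ^ 2 ∂AddCircle.haarAddCircle) := by
  set m : Measure Torus := AddCircle.haarAddCircle with hm
  set c := ∫ t, ‖f t‖ ∂m with hc
  have i1 : Integrable (fun t => ‖f t‖) m :=
    hf.norm.integrable_of_hasCompactSupport (HasCompactSupport.of_compactSpace _)
  have i2 : Integrable (fun t => ‖f t‖ ^ 2) m :=
    (hf.norm.pow 2).integrable_of_hasCompactSupport (HasCompactSupport.of_compactSpace _)
  refine Real.le_sqrt_of_sq_le ?_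
  have h0 : 0 ≤ ∫ t, (‖f t‖ - c) ^ 2 ∂m := integral_nonneg fun t => sq_nonneg _
  have h1 : ∫ t, (‖f t‖ - c) ^ 2 ∂m = (∫ t, ‖f t‖ ^ 2 ∂m) - 2 * c * c + c ^ 2 := by
    have : ∀ t, (‖f t‖ - c) ^ 2 = ‖f t‖ ^ 2 - 2 * c * ‖f t‖ + c ^ 2 := fun t => by ring
    simp_rw [this]
    have i3 : Integrable (fun t => ‖f t‖ ^ 2 - 2 * c * ‖f t‖) m := i2.sub (i1.const_mul _)
    rw [integral_add i3 (integrable_const _), integral_sub i2 (i1.const_mul _),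
      integral_const_mul, ← hc]
    simp [m]
  nlinarith

lemma continuous_herglotzFun_comp_circle {g : Torus → ℂ}
    (hg : Integrable g AddCircle.haarAddCircle) {r : ℝ} (hr : 0 ≤ r) (hr1 : r < 1) :
    Continuous fun t : Torus => herglotzFun g (r * (AddCircle.toCircle t : ℂ)) :=
  continuous_comp_circle (hasSum_herglotzFun hg) hr hr1

/-- The Taylor coefficients of `exp (herglotz μ)` depend on the density of `μ` in a Lipschitz
way for the `L²` norm, uniformly on densities bounded by `R`. -/
lemma norm_taylorCoeff_sub_le {R R' : ℝ} (hR : 0 ≤ R) (hRR' : R ≤ R') {E E' : Set Torus}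
    (hE : MeasurableSet E) (hE' : MeasurableSet E') (n : ℕ) :
    ‖taylorCoeff (expHerglotz (blockMeasure R' E')) n -
        taylorCoeff (expHerglotz (blockMeasure R E)) n‖ ≤
      Real.exp R' * (2 * √(∫ t, ‖E'.indicator (fun _ => (R' : ℂ)) t -
        E.indicator (fun _ => (R : ℂ)) t‖ ^ 2 ∂AddCircle.haarAddCircle)) := by
  have hR' := hR.trans hRR'
  set g : Torus → ℂ := E.indicator fun _ => (R : ℂ) with hg
  set g' : Torus → ℂ := E'.indicator fun _ => (R' : ℂ) with hg'
  have ig : MemLp g 2 AddCircle.haarAddCircle := (memLp_const _).indicator hE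
  have ig' : MemLp g' 2 AddCircle.haarAddCircle := (memLp_const _).indicator hE'
  have igg : MemLp (fun t => g' t - g t) 2 AddCircle.haarAddCircle := ig'.sub ig
  refine norm_coeff_le_of_integral_le (A := fun z => expHerglotz (blockMeasure R' E') z -
    expHerglotz (blockMeasure R E) z) (a := fun n => _ - _) (fun z hz => ?_) (fun r hr hr1 => ?_) n
  · simp_rw [sub_mul]
    exact (hasSum_expHerglotz _ z hz).sub (hasSum_expHerglotz _ z hz)
  · have hc := continuous_herglotzFun_comp_circle (igg.integrable (by norm_num)) hr hr1
    have hpt : ∀ t : Torus, ‖expHerglotz (blockMeasure R' E') (r * (AddCircle.toCircle t : ℂ)) -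
        expHerglotz (blockMeasure R E) (r * (AddCircle.toCircle t : ℂ))‖ ≤
        Real.exp R' * ‖herglotzFun (fun t => g' t - g t) (r * (AddCircle.toCircle t : ℂ))‖ := by
      intro t
      have hz : ‖(r : ℂ) * (AddCircle.toCircle t : ℂ)‖ < 1 := by rwa [norm_real_mul_toCircle hr]
      refine (norm_exp_sub_exp_le (re_herglotz_blockMeasure_le hR' E' hz)
        ((re_herglotz_blockMeasure_le hR E hz).trans hRR')).trans (le_of_eq ?_)
      rw [herglotz_blockMeasure hR' hE', herglotz_blockMeasure hR hE, herglotzFun, herglotzFun,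
        herglotzFun, ← integral_sub]
      · simp_rw [sub_mul, hg, hg']
      · exact (ig'.integrable (by norm_num)).mul_bdd
          (continuous_herglotzKernel hz).aestronglyMeasurable
          (ae_of_all _ (norm_herglotzKernel_le hz))
      · exact (ig.integrable (by norm_num)).mul_bdd
          (continuous_herglotzKernel hz).aestronglyMeasurable
          (ae_of_all _ (norm_herglotzKernel_le hz))
    calc _ ≤ ∫ t : Torus, Real.exp R' *
          ‖herglotzFun (fun t => g' t - g t) (r * (AddCircle.toCircle t : ℂ))‖
            ∂AddCircle.haarAddCircle :=
        integral_mono_of_nonneg (ae_of_all _ fun t => norm_nonneg _)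
          ((continuous_const.mul hc.norm).integrable_of_hasCompactSupport
            (HasCompactSupport.of_compactSpace _)) (ae_of_all _ hpt)
      _ = Real.exp R' * ∫ t : Torus,
          ‖herglotzFun (fun t => g' t - g t) (r * (AddCircle.toCircle t : ℂ))‖
            ∂AddCircle.haarAddCircle := integral_const_mul _ _
      _ ≤ _ := by
        refine mul_le_mul_of_nonneg_left ?_ (Real.exp_pos _).le
        refine (integral_norm_le_sqrt_integral_sq hc).trans ?_
        have h4 := Real.sqrt_le_sqrt (integral_norm_sq_herglotzFun_le igg hr hr1)
        rwa [Real.sqrt_mul (by norm_num), show √(4 : ℝ) = 2 by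
          rw [Real.sqrt_eq_iff_mul_self_eq] <;> norm_num] at h4

/-- The basic step. The density `R` on `E` is multiplied by `(R' / R) 1_A(N t)`, where `A` has
measure `R / R'`. If `N` is large, the low Taylor coefficients of `exp (herglotz μ)` hardly
change, and all of them change by a quantity that is small when `R' - R` is small. -/
lemma exists_refinement {E : Set Torus} (hE : IsClosed E) {R R' : ℝ} (hR : 0 < R) (hRR' : R < R')
    (M : ℕ) {η : ℝ} (hη : 0 < η) :
    ∃ E' ⊆ E, IsClosed E' ∧
      (∀ n ≤ M, ‖taylorCoeff (expHerglotz (blockMeasure R' E')) n -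
        taylorCoeff (expHerglotz (blockMeasure R E)) n‖ ≤ η) ∧
      ∀ n, ‖taylorCoeff (expHerglotz (blockMeasure R' E')) n -
        taylorCoeff (expHerglotz (blockMeasure R E)) n‖ ≤
          Real.exp R' * (2 * √(R * (R' - R))) := by
  have hR' : 0 < R' := hR.trans hRR'
  obtain ⟨A, hA, hAm⟩ := exists_isClosed_haar_eq (θ := R / R') (by positivity)
    ((div_le_one hR').2 hRR'.le)
  set w : Torus → ℂ := A.indicator fun _ => (R' : ℂ) with hw
  have hwm : Measurable w := measurable_const.indicator hA.measurableSet
  have hwC : ∀ t, ‖w t‖ ≤ R' := fun t => by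
    by_cases ht : t ∈ A <;> simp [hw, ht, hR'.le, abs_of_pos hR']
  have hwI : ∫ t, w t ∂AddCircle.haarAddCircle = (R : ℂ) := by
    rw [hw, integral_indicator hA.measurableSet, setIntegral_const, hAm]
    rw [Complex.real_smul]
    push_cast
    have : (R' : ℂ) ≠ 0 := by exact_mod_cast hR'.ne'
    field_simp
  -- frequency `N + 1` instead of `N`, since `t ↦ 0 • t` does not preserve the measure
  set E' : ℕ → Set Torus := fun N => E ∩ (fun t : Torus => (N + 1) • t) ⁻¹' A with hE'
  have hE'c : ∀ N, IsClosed (E' N) := fun N => hE.inter (hA.preimage (by fun_prop))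
  have hind : ∀ N t, (E' N).indicator (fun _ => (R' : ℂ)) t =
      E.indicator (fun _ => (1 : ℂ)) t * w ((N + 1) • t) := by
    intro N t
    by_cases h1 : t ∈ E <;> by_cases h2 : (N + 1) • t ∈ A <;> simp [hE', hw, h1, h2]
  have hlim : ∀ z : ℂ, ‖z‖ < 1 → Tendsto (fun N => expHerglotz (blockMeasure R' (E' N)) z) atTop
      (𝓝 (expHerglotz (blockMeasure R E) z)) := by
    intro z hz
    refine ((Complex.continuous_exp.tendsto _).comp ?_)
    rw [herglotz_blockMeasure hR.le hE.measurableSet]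
    simp_rw [fun N => herglotz_blockMeasure hR'.le (hE'c N).measurableSet z]
    have hgi : Integrable (fun t => E.indicator (fun _ => (1 : ℂ)) t * herglotzKernel z t)
        AddCircle.haarAddCircle :=
      ((integrable_const (1 : ℂ)).indicator hE.measurableSet).mul_bdd
        (continuous_herglotzKernel hz).aestronglyMeasurable
        (ae_of_all _ (norm_herglotzKernel_le hz))
    have hF := (tendsto_integral_mul_comp_nsmul hgi hwm hwC).comp (tendsto_add_atTop_nat 1)
    convert! hF using 1
    · funext N
      simp only [herglotzFun, hind, Function.comp]
      congr 1
      funext t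
      ring
    · rw [hwI, herglotzFun, ← integral_mul_const]
      congr 2
      funext t
      by_cases h1 : t ∈ E <;> simp [h1, mul_comm]
  have hcoeff : ∀ n, Tendsto (fun N => taylorCoeff (expHerglotz (blockMeasure R' (E' N))) n) atTop
      (𝓝 (taylorCoeff (expHerglotz (blockMeasure R E)) n)) := fun n =>
    tendsto_coeff_of_tendsto (hasSum_expHerglotz _) (fun N => hasSum_expHerglotz _)
      (r := 1 / 2) (by norm_num) (by norm_num) (M := Real.exp R')
      (fun N z hz => norm_expHerglotz_blockMeasure_le hR'.le _ (by rw [hz]; norm_num))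
      (fun z hz => hlim z (by rw [hz]; norm_num)) n
  have hev : ∀ᶠ N in atTop, ∀ n ∈ Finset.range (M + 1),
      ‖taylorCoeff (expHerglotz (blockMeasure R' (E' N))) n -
        taylorCoeff (expHerglotz (blockMeasure R E)) n‖ ≤ η := by
    refine (Finset.eventually_all _).2 fun n _ => ?_
    have := (tendsto_iff_norm_sub_tendsto_zero.1 (hcoeff n)).eventually (gt_mem_nhds hη)
    exact this.mono fun N hN => hN.le
  obtain ⟨N, hN⟩ := hev.exists
  refine ⟨E' N, Set.inter_subset_left, hE'c N, fun n hn => hN n (Finset.mem_range.2 (by lia)),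
    fun n => ?_⟩
  refine (norm_taylorCoeff_sub_le hR.le hRR'.le hE.measurableSet (hE'c N).measurableSet n).trans ?_
  gcongr
  have hsm : StronglyMeasurable fun t => ‖w t - R‖ ^ 2 :=
    ((hwm.sub_const _).norm.pow_const 2).stronglyMeasurable
  have hb : ∀ t, ‖w t - R‖ ^ 2 ≤ (R' + R) ^ 2 := fun t => by
    have := (norm_sub_le (w t) (R : ℂ)).trans (add_le_add (hwC t) (le_of_eq
      (by rw [Complex.norm_real, Real.norm_of_nonneg hR.le])))
    gcongr
  calc _ ≤ ∫ t, ‖w ((N + 1) • t) - R‖ ^ 2 ∂AddCircle.haarAddCircle := by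
        refine integral_mono_of_nonneg (ae_of_all _ fun t => sq_nonneg _) ?_
          (ae_of_all _ fun t => ?_)
        · refine Integrable.of_bound (C := (R' + R) ^ 2)
            (hsm.measurable.comp (g := fun t : Torus => ‖w t - R‖ ^ 2)
              (f := fun t : Torus => (N + 1) • t) (by fun_prop)).aestronglyMeasurable
            (ae_of_all _ fun t => ?_)
          rw [Real.norm_of_nonneg (by positivity)]
          exact hb _
        · simp only [hind]
          by_cases h1 : t ∈ E
          · simp [h1]
          · refine le_of_eq_of_le ?_ (sq_nonneg _)
            simp [h1]
    _ = ∫ t, ‖w t - R‖ ^ 2 ∂AddCircle.haarAddCircle :=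
        integral_comp_nsmul (w := fun t => ‖w t - R‖ ^ 2) hsm (N := N + 1) (by lia)
    _ = ∫ t, (A.indicator (fun _ => R' * (R' - 2 * R)) t + R ^ 2) ∂AddCircle.haarAddCircle := by
        congr 1
        funext t
        by_cases ht : t ∈ A
        · simp only [hw, ht, Set.indicator_of_mem, ← Complex.ofReal_sub, Complex.norm_real,
            Real.norm_eq_abs, sq_abs]
          ring
        · simp [hw, ht]
    _ = R * (R' - R) := by
        rw [integral_add ((integrable_const _).indicator hA.measurableSet) (integrable_const _),
          integral_indicator hA.measurableSet, setIntegral_const, hAm]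
        simp
        field_simp
        ring

/-! ### The inductive construction -/

/-- Densities that grow to infinity so slowly that the changes of the Taylor coefficients
allowed by `exists_refinement` tend to zero. -/
lemma exists_slow_densities :
    ∃ R : ℕ → ℝ, R 0 = 1 ∧ StrictMono R ∧ Tendsto R atTop atTop ∧
      Tendsto (fun k => Real.exp (R (k + 1)) * (2 * √(R k * (R (k + 1) - R k)))) atTop (𝓝 0) := by
  set L : ℕ → ℝ := fun k => Real.log (k + 1) with hL
  have hLt : Tendsto L atTop atTop :=
    Real.tendsto_log_atTop.comp (tendsto_atTop_add_const_right _ _ tendsto_natCast_atTop_atTop)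
  have hL0 : ∀ k, 0 ≤ L k := fun k => Real.log_nonneg (by
    have : (0 : ℝ) ≤ k := k.cast_nonneg
    linarith)
  have hstep : ∀ k, L (k + 1) - L k ≤ Real.exp (-L k) := by
    intro k
    have hk : (0 : ℝ) < k + 1 := by positivity
    have h1 : L (k + 1) - L k = Real.log ((k + 1 + 1) / (k + 1)) := by
      simp only [hL]
      rw [Real.log_div (by positivity) hk.ne']
      push_cast
      ring
    rw [h1, hL, Real.exp_neg, Real.exp_log hk]
    refine (Real.log_le_sub_one_of_pos (by positivity)).trans (le_of_eq ?_)
    field_simp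
    ring
  have hmono : StrictMono L := strictMono_nat_of_lt_succ fun k => by
    refine Real.log_lt_log (by positivity) ?_
    push_cast
    linarith
  -- `1 + L / 4 ≤ e^{L / 4}` and `L (k + 1) - L k ≤ e^{-L k}`, so the bound is `O(e^{-L k / 8})`
  refine ⟨fun k => 1 + L k / 4, by simp [hL], fun i j h => ?_, ?_, ?_⟩
  · have := hmono h
    simp only
    linarith
  · exact tendsto_atTop_add_const_left _ _ (hLt.atTop_div_const (by norm_num))
  · have hbound : ∀ k, Real.exp (1 + L (k + 1) / 4) *
        (2 * √((1 + L k / 4) * (1 + L (k + 1) / 4 - (1 + L k / 4)))) ≤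
          Real.exp (5 / 4 + -(L k / 8)) := by
      intro k
      have h1 := hstep k
      have h2 : Real.exp (-L k) ≤ 1 := Real.exp_le_one_iff.2 (by linarith [hL0 k])
      have h3 : 1 + L k / 4 ≤ Real.exp (L k / 4) := by linarith [Real.add_one_le_exp (L k / 4)]
      have h4 : (1 + L k / 4) * (1 + L (k + 1) / 4 - (1 + L k / 4)) ≤
          (Real.exp (-(3 / 8 * L k)) / 2) ^ 2 := by
        have h5 : (Real.exp (-(3 / 8 * L k)) / 2) ^ 2 =
            Real.exp (L k / 4) * (Real.exp (-L k) / 4) := by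
          rw [div_pow, sq, ← Real.exp_add, ← mul_div_assoc, ← Real.exp_add]
          congr 1
          · congr 1; ring
          · norm_num
        rw [h5]
        refine mul_le_mul h3 (by linarith) ?_ (Real.exp_pos _).le
        linarith [hmono (Nat.lt_succ_self k)]
      have h6 : √((1 + L k / 4) * (1 + L (k + 1) / 4 - (1 + L k / 4))) ≤
          Real.exp (-(3 / 8 * L k)) / 2 :=
        (Real.sqrt_le_sqrt h4).trans (le_of_eq (Real.sqrt_sq (by positivity)))
      calc _ ≤ Real.exp (5 / 4 + L k / 4) * (2 * (Real.exp (-(3 / 8 * L k)) / 2)) := by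
            refine mul_le_mul (Real.exp_le_exp.2 (by linarith)) ?_ (by positivity) (by positivity)
            linarith
        _ = Real.exp (5 / 4 + -(L k / 8)) := by
            rw [mul_div_cancel₀ _ (two_ne_zero), ← Real.exp_add]
            congr 1
            ring
    refine squeeze_zero (fun k => by positivity) hbound ?_
    refine Real.tendsto_exp_atBot.comp (tendsto_atBot_add_const_left _ _ ?_)
    exact tendsto_neg_atTop_atBot.comp (hLt.atTop_div_const (by norm_num))

/-- The nested closed sets `E k`, together with frequencies `M k` that separate the ranges where
successive steps change the Taylor coefficients. -/
lemma exists_nested_sets {R : ℕ → ℝ} (hR0 : R 0 = 1) (hR : StrictMono R) :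
    ∃ (E : ℕ → Set Torus) (M : ℕ → ℕ), E 0 = Set.univ ∧ (∀ k, IsClosed (E k)) ∧ Antitone E ∧
      (∀ k, k ≤ M k) ∧ Monotone M ∧
      (∀ k n, M k ≤ n →
        ‖taylorCoeff (expHerglotz (blockMeasure (R k) (E k))) n‖ ≤ (1 / 2) ^ (k + 2)) ∧
      (∀ k n, n ≤ M k → ‖taylorCoeff (expHerglotz (blockMeasure (R (k + 1)) (E (k + 1)))) n -
        taylorCoeff (expHerglotz (blockMeasure (R k) (E k))) n‖ ≤ (1 / 2) ^ (k + 2)) ∧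
      (∀ k n, ‖taylorCoeff (expHerglotz (blockMeasure (R (k + 1)) (E (k + 1)))) n -
        taylorCoeff (expHerglotz (blockMeasure (R k) (E k))) n‖ ≤
          Real.exp (R (k + 1)) * (2 * √(R k * (R (k + 1) - R k)))) := by
  have hpos : ∀ k, 0 < R k := fun k => by
    have := hR.monotone (Nat.zero_le k)
    linarith
  have step : ∀ (k : ℕ) (s : {s : Set Torus × ℕ // IsClosed s.1}),
      ∃ s' : {s : Set Torus × ℕ // IsClosed s.1}, s'.1.1 ⊆ s.1.1 ∧ s.1.2 ≤ s'.1.2 ∧ k ≤ s'.1.2 ∧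
        (∀ n, s'.1.2 ≤ n →
          ‖taylorCoeff (expHerglotz (blockMeasure (R k) s.1.1)) n‖ ≤ (1 / 2) ^ (k + 2)) ∧
        (∀ n, n ≤ s'.1.2 → ‖taylorCoeff (expHerglotz (blockMeasure (R (k + 1)) s'.1.1)) n -
          taylorCoeff (expHerglotz (blockMeasure (R k) s.1.1)) n‖ ≤ (1 / 2) ^ (k + 2)) ∧
        (∀ n, ‖taylorCoeff (expHerglotz (blockMeasure (R (k + 1)) s'.1.1)) n -
          taylorCoeff (expHerglotz (blockMeasure (R k) s.1.1)) n‖ ≤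
            Real.exp (R (k + 1)) * (2 * √(R k * (R (k + 1) - R k)))) := by
    rintro k ⟨⟨E, M₀⟩, hE⟩
    have ht : Tendsto (taylorCoeff (expHerglotz (blockMeasure (R k) E))) atTop (𝓝 0) :=
      tendsto_coeff_zero_of_bounded (hasSum_expHerglotz _)
        (fun z hz => norm_expHerglotz_blockMeasure_le (hpos k).le E hz)
    obtain ⟨T, hT⟩ := Metric.tendsto_atTop.1 ht ((1 / 2) ^ (k + 2)) (by positivity)
    obtain ⟨E', hsub, hE', hlow, hall⟩ := exists_refinement hE (hpos k) (hR (Nat.lt_succ_self k))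
      (max M₀ (max k T)) (η := (1 / 2) ^ (k + 2)) (by positivity)
    refine ⟨⟨(E', max M₀ (max k T)), hE'⟩, hsub, le_max_left _ _,
      (le_max_left _ _).trans (le_max_right _ _), fun n hn => ?_, hlow, hall⟩
    have := hT n (((le_max_right _ _).trans (le_max_right _ _)).trans hn)
    rw [dist_zero_right] at this
    exact this.le
  choose next h1 h2 h3 h4 h5 h6 using step
  let s : ℕ → {s : Set Torus × ℕ // IsClosed s.1} := fun k =>
    Nat.rec ⟨(Set.univ, 0), isClosed_univ⟩ (fun k s => next k s) k
  exact ⟨fun k => (s k).1.1, fun k => (s (k + 1)).1.2, rfl, fun k => (s k).2,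
    antitone_nat_of_succ_le fun k => h1 k (s k), fun k => h3 k (s k),
    monotone_nat_of_le_succ fun k => h2 (k + 1) (s (k + 1)), fun k => h4 k (s k),
    fun k => h5 k (s k), fun k => h6 k (s k)⟩

section Telescoping

variable {x : ℕ → ℕ → ℂ} {M : ℕ → ℕ}

lemma norm_sub_le_of_frequency_le (hM : Monotone M)
    (hlow : ∀ k n, n ≤ M k → ‖x (k + 1) n - x k n‖ ≤ (1 / 2) ^ (k + 2)) {k j n : ℕ}
    (hn : n ≤ M k) (hkj : k ≤ j) : ‖x j n - x k n‖ ≤ (1 / 2) ^ (k + 1) := by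
  have : ‖x j n - x k n‖ ≤ (1 / 2) ^ (k + 1) - (1 / 2) ^ (j + 1) := by
    induction j, hkj using Nat.le_induction with
    | base => simp
    | succ j hkj ih =>
      have h1 := hlow j n (hn.trans (hM hkj))
      have h2 := norm_add_le (x (j + 1) n - x j n) (x j n - x k n)
      rw [sub_add_sub_cancel] at h2
      have h3 : ((1 : ℝ) / 2) ^ (j + 1) = 2 * (1 / 2) ^ (j + 2) := by rw [pow_succ]; ring
      rw [show j + 1 + 1 = j + 2 from rfl]
      linarith
  have h0 : (0 : ℝ) < (1 / 2) ^ (j + 1) := by positivity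
  linarith

/-- Since the `k`-th step changes the coefficients essentially between the frequencies `M k` and
`M (k + 1)`, the changes do not accumulate: the limit sequence tends to zero as soon as the sizes
`ε k` of the changes do, even if `ε` is not summable. -/
lemma tendsto_zero_of_separated_changes {ε : ℕ → ℝ} {c : ℕ → ℂ} {φ : ℕ → ℕ}
    (hM : Monotone M) (hkM : ∀ k, k ≤ M k)
    (htail : ∀ k n, M k ≤ n → ‖x k n‖ ≤ (1 / 2) ^ (k + 2))
    (hlow : ∀ k n, n ≤ M k → ‖x (k + 1) n - x k n‖ ≤ (1 / 2) ^ (k + 2))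
    (hall : ∀ k n, ‖x (k + 1) n - x k n‖ ≤ ε k) (hε : Tendsto ε atTop (𝓝 0))
    (hφ : Tendsto φ atTop atTop) (hc : ∀ n, Tendsto (fun j => x (φ j) n) atTop (𝓝 (c n))) :
    Tendsto c atTop (𝓝 0) := by
  have hclose : ∀ k n, n ≤ M k → ‖c n - x k n‖ ≤ (1 / 2) ^ (k + 1) := by
    intro k n hn
    refine le_of_tendsto ((hc n).sub_const _).norm ?_
    filter_upwards [hφ.eventually_ge_atTop k] with j hj
    exact norm_sub_le_of_frequency_le hM hlow hn hj
  have hb : Tendsto (fun i : ℕ => ((1 : ℝ) / 2) ^ (i + 2) + ε i + (1 / 2) ^ (i + 2)) atTop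
      (𝓝 (0 + 0 + 0)) := by
    have h2 := (tendsto_pow_atTop_nhds_zero_of_lt_one (r := (1 : ℝ) / 2) (by norm_num)
      (by norm_num)).comp (tendsto_add_atTop_nat 2)
    exact (h2.add hε).add h2
  rw [add_zero, add_zero] at hb
  rw [Metric.tendsto_atTop]
  intro δ hδ
  obtain ⟨i₀, hi₀⟩ := eventually_atTop.1 (hb.eventually (gt_mem_nhds hδ))
  refine ⟨M i₀ + 1, fun n hn => ?_⟩
  have hex : ∃ k, n ≤ M k := ⟨n, hkM n⟩
  have hk := Nat.find_spec hex
  have hlt : i₀ < Nat.find hex := by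
    by_contra hcon
    have := hM (not_lt.1 hcon)
    lia
  obtain ⟨i, hi⟩ : ∃ i, Nat.find hex = i + 1 := ⟨Nat.find hex - 1, by lia⟩
  rw [hi] at hk hlt
  have hni : M i < n := not_le.1 (Nat.find_min hex (by lia))
  have h1 := htail i n hni.le
  have h2 := hall i n
  have h3 := hclose (i + 1) n hk
  have h4 := norm_add₃_le (a := c n - x (i + 1) n) (b := x (i + 1) n - x i n) (c := x i n)
  rw [sub_add_sub_cancel, sub_add_cancel] at h4
  rw [dist_zero_right]
  have h5 := hi₀ i (by lia)
  rw [show i + 1 + 1 = i + 2 from rfl] at h3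
  linarith

end Telescoping

/-! ### Weak limits of measures -/

/-- A bounded sequence of nonzero measures on the circle has a weakly convergent subsequence, and
the limit is carried by every closed set that carries almost all the measures. -/
lemma exists_weak_limit (ν : ℕ → Measure Torus) [∀ k, IsFiniteMeasure (ν k)] {B : ℝ}
    (hB : ∀ k, (ν k).real Set.univ ≤ B) (h0 : ∀ k, ν k ≠ 0) :
    ∃ (μ : Measure Torus) (φ : ℕ → ℕ), IsFiniteMeasure μ ∧ StrictMono φ ∧
      (∀ g : C(Torus, ℂ), Tendsto (fun j => ∫ t, g t ∂ν (φ j)) atTop (𝓝 (∫ t, g t ∂μ))) ∧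
      ∀ F : Set Torus, IsClosed F → (∀ᶠ k in atTop, ν k Fᶜ = 0) → μ Fᶜ = 0 := by
  have hmass : ∀ k, (ν k).real Set.univ ∈ Set.Icc 0 B := fun k => ⟨measureReal_nonneg, hB k⟩
  have hne : ∀ k, ν k Set.univ ≠ 0 := fun k => Measure.measure_univ_ne_zero.2 (h0 k)
  have hP : ∀ k, IsProbabilityMeasure ((ν k Set.univ)⁻¹ • ν k) := fun k =>
    have : NeZero (ν k) := ⟨h0 k⟩
    isProbabilityMeasureSMul
  let P : ℕ → ProbabilityMeasure Torus := fun k => ⟨(ν k Set.univ)⁻¹ • ν k, hP k⟩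
  have hν : ∀ (k : ℕ) (g : Torus → ℂ), ∫ t, g t ∂ν k =
      (ν k).real Set.univ • ∫ t, g t ∂(P k : Measure Torus) := by
    intro k g
    have : ((P k : ProbabilityMeasure Torus) : Measure Torus) = (ν k Set.univ)⁻¹ • ν k := rfl
    rw [this, integral_smul_measure, smul_smul, measureReal_def, ← ENNReal.toReal_mul,
      ENNReal.mul_inv_cancel (hne k) (measure_ne_top _ _), ENNReal.toReal_one, one_smul]
  obtain ⟨b, hb, φ₁, hφ₁, hlim₁⟩ := isCompact_Icc.tendsto_subseq hmass
  obtain ⟨Q, -, φ₂, hφ₂, hlim₂⟩ :=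
    (isCompact_univ (X := ProbabilityMeasure Torus)).tendsto_subseq (x := P ∘ φ₁)
      fun _ => Set.mem_univ _
  refine ⟨ENNReal.ofReal b • (Q : Measure Torus), φ₁ ∘ φ₂,
    Measure.smul_finite _ ENNReal.ofReal_ne_top, hφ₁.comp hφ₂, fun g => ?_, fun F hF hev => ?_⟩
  · rw [integral_smul_measure, ENNReal.toReal_ofReal hb.1]
    have h1 := (ProbabilityMeasure.tendsto_iff_forall_integral_rclike_tendsto ℂ).1 hlim₂
      (BoundedContinuousFunction.mkOfCompact g)
    have h2 := (hlim₁.comp hφ₂.tendsto_atTop).smul h1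
    convert! h2 using 1
    funext j
    exact hν _ _
  · have hopen := ProbabilityMeasure.le_liminf_measure_open_of_tendsto hlim₂ hF.isOpen_compl
    have hz : ∀ᶠ j in atTop, ((P ∘ φ₁) (φ₂ j) : Measure Torus) Fᶜ = 0 := by
      filter_upwards [(hφ₁.comp hφ₂).tendsto_atTop.eventually hev] with j hj
      change ((ν (φ₁ (φ₂ j)) Set.univ)⁻¹ • ν (φ₁ (φ₂ j))) Fᶜ = 0
      rw [Measure.smul_apply, show ν (φ₁ (φ₂ j)) Fᶜ = 0 from hj, smul_zero]
    have hlim0 : liminf (fun j => ((P ∘ φ₁) (φ₂ j) : Measure Torus) Fᶜ) atTop = 0 := by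
      rw [liminf_congr hz]
      simp
    have : (Q : Measure Torus) Fᶜ = 0 := le_antisymm (hopen.trans (le_of_eq hlim0)) zero_le
    rw [Measure.smul_apply, this, smul_zero]

/-! ### The Fatou–Riesz localization theorem -/

/-- Estimate of the partial sums outside the disk. The proof is an induction on `k` for the weighted
sums `S N = e^{-Nu} ∑_{n < N} c(n) e^{nu}`, which satisfy `S (N + 1) = e^{-u} (S N + c N)`; the
inequality `e^{-u} (1 + u) ≤ 1` closes it. -/
lemma mul_weighted_sum_le {c : ℕ → ℝ} (hc0 : ∀ n, 0 ≤ c n) {ε : ℝ} {n₀ : ℕ}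
    (hc : ∀ n, n₀ ≤ n → c n ≤ ε) {u : ℝ} (hu : 0 ≤ u) (k : ℕ) :
    u * (Real.exp (-((n₀ + k : ℕ) * u)) * ∑ n ∈ Finset.range (n₀ + k), c n * Real.exp (n * u)) ≤
      ε + u * Real.exp (-(k * u)) * ∑ n ∈ Finset.range n₀, c n := by
  have hε : 0 ≤ ε := (hc0 n₀).trans (hc n₀ le_rfl)
  induction k with
  | zero =>
    have : Real.exp (-((n₀ + 0 : ℕ) * u)) * ∑ n ∈ Finset.range (n₀ + 0), c n * Real.exp (n * u) ≤
        ∑ n ∈ Finset.range n₀, c n := by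
      rw [add_zero, Finset.mul_sum]
      refine Finset.sum_le_sum fun n hn => ?_
      rw [mul_left_comm, ← Real.exp_add]
      refine mul_le_of_le_one_right (hc0 n) (Real.exp_le_one_iff.2 ?_)
      have : (n : ℝ) ≤ n₀ := by exact_mod_cast (Finset.mem_range.1 hn).le
      nlinarith
    have h2 := mul_le_mul_of_nonneg_left this hu
    simp only [Nat.cast_zero, zero_mul, neg_zero, Real.exp_zero, mul_one]
    linarith
  | succ k ih =>
    rw [← add_assoc, Finset.sum_range_succ]
    set S := ∑ n ∈ Finset.range (n₀ + k), c n * Real.exp (n * u) with hS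
    set B := ∑ n ∈ Finset.range n₀, c n with hB
    have h1 : Real.exp (-((n₀ + k + 1 : ℕ) * u)) =
        Real.exp (-u) * Real.exp (-((n₀ + k : ℕ) * u)) := by
      rw [← Real.exp_add]; congr 1; push_cast; ring
    have h2 : Real.exp (-((k + 1 : ℕ) * u)) = Real.exp (-u) * Real.exp (-(k * u)) := by
      rw [← Real.exp_add]; congr 1; push_cast; ring
    have h3 : Real.exp (-((n₀ + k : ℕ) * u)) * Real.exp ((n₀ + k : ℕ) * u) = 1 := by
      rw [← Real.exp_add]; simp
    have h4 : Real.exp (-u) * (1 + u) ≤ 1 := by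
      have h5 : Real.exp (-u) * Real.exp u = 1 := by rw [← Real.exp_add]; simp
      rw [← h5]
      refine mul_le_mul_of_nonneg_left ?_ (Real.exp_pos _).le
      linarith [Real.add_one_le_exp u]
    have h6 := hc (n₀ + k) (by lia)
    calc _ = Real.exp (-u) * (u * (Real.exp (-((n₀ + k : ℕ) * u)) * S) + u * c (n₀ + k) *
          (Real.exp (-((n₀ + k : ℕ) * u)) * Real.exp ((n₀ + k : ℕ) * u))) := by
          rw [h1]; ring
      _ ≤ Real.exp (-u) * ((ε + u * Real.exp (-(k * u)) * B) + u * ε * 1) := by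
          rw [h3]
          gcongr
      _ = ε * (Real.exp (-u) * (1 + u)) + u * (Real.exp (-u) * Real.exp (-(k * u))) * B := by ring
      _ ≤ _ := by
          rw [h2]
          have := mul_le_mul_of_nonneg_left h4 hε
          linarith

lemma mul_exp_neg_le_inv {k : ℕ} (hk : 0 < k) (u : ℝ) :
    u * Real.exp (-(k * u)) ≤ 1 / k := by
  have hk' : (0 : ℝ) < k := by exact_mod_cast hk
  rw [le_div_iff₀ hk']
  have h1 : Real.exp (-(k * u)) * Real.exp (k * u) = 1 := by rw [← Real.exp_add]; simp
  rw [← h1]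
  have := Real.add_one_le_exp (k * u)
  have h2 := mul_le_mul_of_nonneg_left (show k * u ≤ Real.exp (k * u) by linarith)
    (Real.exp_pos (-(k * u))).le
  linarith

section FatouRiesz

variable {c : ℕ → ℂ} {F : ℂ → ℂ}

/-- On the circle of radius `e^{-y} < 1` the remainder is `O(ε e^{-Ny} / y)`. -/
lemma norm_remainder_inside_le (hF : ∀ z : ℂ, ‖z‖ < 1 → HasSum (fun n => c n * z ^ n) (F z))
    {ε : ℝ} {N : ℕ} (hε : ∀ n, N ≤ n → ‖c n‖ ≤ ε) {z : ℂ} {y : ℝ} (hy : 0 < y) (hy1 : y ≤ 1)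
    (hz : ‖z‖ = Real.exp (-y)) :
    y * (‖F z - ∑ n ∈ Finset.range N, c n * z ^ n‖ * Real.exp (N * y)) ≤ 3 * ε := by
  have hε0 : 0 ≤ ε := (norm_nonneg _).trans (hε N le_rfl)
  have hz1 : ‖z‖ < 1 := by rw [hz, Real.exp_lt_one_iff]; linarith
  have h1 : HasSum (fun n => c (n + N) * z ^ (n + N)) (F z - ∑ n ∈ Finset.range N, c n * z ^ n) :=
    (hasSum_nat_add_iff' (f := fun n => c n * z ^ n) N).2 (hF z hz1)
  have hg := (hasSum_geometric_of_lt_one (norm_nonneg z) hz1).mul_left (ε * ‖z‖ ^ N)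
  have h2 : ‖F z - ∑ n ∈ Finset.range N, c n * z ^ n‖ ≤ ε * ‖z‖ ^ N * (1 - ‖z‖)⁻¹ := by
    rw [← h1.tsum_eq]
    refine tsum_of_norm_bounded hg fun n => ?_
    rw [norm_mul, norm_pow, pow_add, mul_assoc ε, mul_comm (‖z‖ ^ N)]
    exact mul_le_mul_of_nonneg_right (hε _ (by lia)) (by positivity)
  have h3 : ‖z‖ ^ N * Real.exp (N * y) = 1 := by
    rw [hz, ← Real.exp_nat_mul, ← Real.exp_add]; simp
  have h4 : 0 < 1 - ‖z‖ := by linarith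
  have h5 : y * (1 - ‖z‖)⁻¹ ≤ 3 := by
    rw [← div_eq_mul_inv, div_le_iff₀ h4, hz]
    have e1 : Real.exp (-y) * Real.exp y = 1 := by rw [← Real.exp_add]; simp
    have e2 := Real.add_one_le_exp y
    have e3 : Real.exp (-y) * (y + 1) ≤ 1 := by
      exact (mul_le_mul_of_nonneg_left e2 (Real.exp_pos _).le).trans e1.le
    have e4 : 1 / 3 ≤ Real.exp (-y) := by
      have : Real.exp (-1) ≤ Real.exp (-y) := Real.exp_le_exp.2 (by linarith)
      have h7 : Real.exp 1 ≤ 3 := by linarith [Real.exp_one_lt_d9]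
      have : Real.exp (-1) = 1 / Real.exp 1 := by rw [Real.exp_neg, one_div]
      have : 1 / 3 ≤ 1 / Real.exp 1 := one_div_le_one_div_of_le (Real.exp_pos _) h7
      linarith
    nlinarith
  calc _ ≤ y * (ε * ‖z‖ ^ N * (1 - ‖z‖)⁻¹ * Real.exp (N * y)) := by gcongr
    _ = ε * (y * (1 - ‖z‖)⁻¹) * (‖z‖ ^ N * Real.exp (N * y)) := by ring
    _ ≤ ε * 3 * 1 := by rw [h3]; gcongr
    _ = _ := by ring

/-- On the circle of radius `e^u > 1`, any value of size at most `C` differs from the partial sum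
of order `N = n₀ + k` by at most `(ε + O(1 / k)) e^{Nu} / u`. -/
lemma norm_remainder_outside_le {ε C : ℝ} {n₀ k : ℕ} (hε : ∀ n, n₀ ≤ n → ‖c n‖ ≤ ε) (hk : 0 < k)
    {z : ℂ} {u : ℝ} (hu : 0 < u) (hz : ‖z‖ = Real.exp u) (hC : ‖F z‖ ≤ C) :
    u * (‖F z - ∑ n ∈ Finset.range (n₀ + k), c n * z ^ n‖ * Real.exp (-((n₀ + k : ℕ) * u))) ≤
      ε + (C + ∑ n ∈ Finset.range n₀, ‖c n‖) / k := by
  have hC0 : 0 ≤ C := (norm_nonneg _).trans hC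
  have hB0 : 0 ≤ ∑ n ∈ Finset.range n₀, ‖c n‖ := Finset.sum_nonneg fun n _ => norm_nonneg _
  have h1 := mul_weighted_sum_le (fun n => norm_nonneg (c n)) hε hu.le k
  have h2 := mul_exp_neg_le_inv hk u
  have h3 : ‖F z - ∑ n ∈ Finset.range (n₀ + k), c n * z ^ n‖ ≤
      C + ∑ n ∈ Finset.range (n₀ + k), ‖c n‖ * Real.exp (n * u) := by
    refine (norm_sub_le _ _).trans (add_le_add hC ((norm_sum_le _ _).trans (le_of_eq ?_)))
    refine Finset.sum_congr rfl fun n _ => ?_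
    rw [norm_mul, norm_pow, hz, Real.exp_nat_mul]
  have h4 : u * Real.exp (-((n₀ + k : ℕ) * u)) ≤ u * Real.exp (-(k * u)) := by
    gcongr
    simp
  have h5 := mul_le_mul_of_nonneg_right h2 hB0
  have h6 := mul_le_mul_of_nonneg_right (h4.trans h2) hC0
  calc _ ≤ u * ((C + ∑ n ∈ Finset.range (n₀ + k), ‖c n‖ * Real.exp (n * u)) *
        Real.exp (-((n₀ + k : ℕ) * u))) := by gcongr
    _ = u * Real.exp (-((n₀ + k : ℕ) * u)) * C + u * (Real.exp (-((n₀ + k : ℕ) * u)) *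
        ∑ n ∈ Finset.range (n₀ + k), ‖c n‖ * Real.exp (n * u)) := by ring
    _ ≤ 1 / k * C + (ε + 1 / k * ∑ n ∈ Finset.range n₀, ‖c n‖) := by linarith
    _ = _ := by ring

/-- **The Fatou–Riesz theorem.** If the coefficients of a power series tend to zero and its sum
extends analytically across an arc, then the partial sums converge uniformly on every smaller
closed arc. With `s N` the partial sum, the maximum principle on a rectangle is applied to
`w ↦ (F - s N) (e^{iw}) e^{-iNw} (w - α) (w - β)`: the last two factors compensate the growth of
the remainder near the points where the boundary of the rectangle crosses the real axis. -/
lemma fatou_riesz (hc : Tendsto c atTop (𝓝 0))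
    (hF : ∀ z : ℂ, ‖z‖ < 1 → HasSum (fun n => c n * z ^ n) (F z)) {α a b β : ℝ} (hαa : α < a)
    (hbβ : b < β)
    (hd : ∀ w ∈ Set.Icc α β ×ℂ Set.Icc (-1) 1, DifferentiableAt ℂ F (Complex.exp (w * Complex.I)))
    {ε : ℝ} (hε : 0 < ε) :
    ∀ᶠ N in atTop, ∀ x ∈ Set.Icc a b, ‖F (Complex.exp (x * Complex.I)) -
      ∑ n ∈ Finset.range N, c n * Complex.exp (x * Complex.I) ^ n‖ ≤ ε := by
  rcases lt_or_ge b a with hba | hab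
  · exact Eventually.of_forall fun N x hx => absurd (hx.1.trans hx.2) (not_le.2 hba)
  have hαβ : α < β := by linarith
  set U : Set ℂ := Set.Ioo α β ×ℂ Set.Ioo (-1) 1 with hU
  have hcl : closure U = Set.Icc α β ×ℂ Set.Icc (-1) 1 := by
    rw [hU, Complex.closure_reProdIm, closure_Ioo hαβ.ne, closure_Ioo (by norm_num)]
  have hUb : Bornology.IsBounded U := (Metric.isBounded_Ioo α β).reProdIm (Metric.isBounded_Ioo _ _)
  have hcomp : IsCompact (closure U) := hUb.isCompact_closure
  have hcont : ContinuousOn (fun w : ℂ => F (Complex.exp (w * Complex.I))) (closure U) := by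
    intro w hw
    rw [hcl] at hw
    exact ((hd w hw).continuousAt.comp (f := fun w : ℂ => Complex.exp (w * Complex.I))
      (by fun_prop)).continuousWithinAt
  obtain ⟨C, hC⟩ := hcomp.exists_bound_of_continuousOn hcont
  have hnorm : ∀ w : ℂ, ‖Complex.exp (w * Complex.I)‖ = Real.exp (-w.im) := fun w => by
    rw [Complex.norm_exp]; simp
  set D : ℝ := (β - α + 1) ^ 2 with hD
  have hD0 : 0 < D := by positivity
  have hρ : 0 < (a - α) * (β - b) := mul_pos (by linarith) (by linarith)
  set κ : ℝ := ε * ((a - α) * (β - b)) / D / 3 with hκ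
  have hκ0 : 0 < κ := by positivity
  obtain ⟨n₀, hn₀⟩ := Metric.tendsto_atTop.1 hc κ hκ0
  have hn₀' : ∀ n, n₀ ≤ n → ‖c n‖ ≤ κ := fun n hn => by
    have := hn₀ n hn
    rw [dist_zero_right] at this
    exact this.le
  obtain ⟨k₀, hk₀⟩ := exists_nat_ge ((C + ∑ n ∈ Finset.range n₀, ‖c n‖) / κ)
  filter_upwards [eventually_ge_atTop (n₀ + (k₀ + 1))] with N hN x hx
  obtain ⟨k, rfl⟩ : ∃ k, N = n₀ + k := ⟨N - n₀, by lia⟩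
  have hk : 0 < k := by lia
  have hkκ : (C + ∑ n ∈ Finset.range n₀, ‖c n‖) / k ≤ κ := by
    have hk' : (0 : ℝ) < k := by exact_mod_cast hk
    have h1 : (k₀ : ℝ) ≤ k := by exact_mod_cast (by lia : k₀ ≤ k)
    rw [div_le_iff₀ hκ0] at hk₀
    rw [div_le_iff₀ hk']
    nlinarith
  -- the exponential factor turns the bounds for the remainder into bounds independent of `N`
  set Q : ℂ → ℂ := fun w => (F (Complex.exp (w * Complex.I)) -
    ∑ n ∈ Finset.range (n₀ + k), c n * Complex.exp (w * Complex.I) ^ n) *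
      Complex.exp (-((n₀ + k : ℕ) * (w * Complex.I))) * ((w - α) * (w - β)) with hQ
  have hQnorm : ∀ w, ‖Q w‖ = ‖F (Complex.exp (w * Complex.I)) -
      ∑ n ∈ Finset.range (n₀ + k), c n * Complex.exp (w * Complex.I) ^ n‖ *
        Real.exp ((n₀ + k : ℕ) * w.im) * (‖w - α‖ * ‖w - β‖) := by
    intro w
    rw [hQ]
    simp only [norm_mul]
    congr 2
    rw [Complex.norm_exp]
    simp [-Nat.cast_add]
  have hdiff : DiffContOnCl ℂ Q U := by
    refine DifferentiableOn.diffContOnCl fun w hw => DifferentiableAt.differentiableWithinAt ?_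
    rw [hcl] at hw
    have h1 : DifferentiableAt ℂ (fun w : ℂ => F (Complex.exp (w * Complex.I))) w :=
      (hd w hw).comp (f := fun w : ℂ => Complex.exp (w * Complex.I)) w (by fun_prop)
    fun_prop
  have hfront : ∀ w ∈ frontier U, ‖(w - α)‖ * ‖w - β‖ ≤ D * |w.im| ∧ |w.im| ≤ 1 := by
    intro w hw
    have hwc : w ∈ closure U := frontier_subset_closure hw
    rw [hcl, Complex.mem_reProdIm] at hwc
    have him : |w.im| ≤ 1 := abs_le.2 hwc.2
    have h1 : ∀ γ ∈ Set.Icc α β, ‖w - γ‖ ≤ (β - α) + |w.im| := fun γ hγ => by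
      refine (Complex.norm_le_abs_re_add_abs_im _).trans ?_
      simp only [Complex.sub_re, Complex.ofReal_re, Complex.sub_im, Complex.ofReal_im, sub_zero]
      gcongr
      rw [abs_le]
      constructor <;> linarith [hwc.1.1, hwc.1.2, hγ.1, hγ.2]
    have h2 : ∀ γ : ℝ, w.re = γ → ‖w - γ‖ ≤ |w.im| := fun γ hγ => by
      refine (Complex.norm_le_abs_re_add_abs_im _).trans ?_
      simp [hγ]
    have hα := h1 α ⟨le_rfl, hαβ.le⟩
    have hβ := h1 β ⟨hαβ.le, le_rfl⟩
    have h0 := abs_nonneg w.im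
    refine ⟨?_, him⟩
    rw [hU, Complex.frontier_reProdIm, frontier_Ioo hαβ, frontier_Ioo (by norm_num)] at hw
    rcases hw with hw | hw
    · have h3 : |w.im| = 1 := by
        rcases (Complex.mem_reProdIm.1 hw).2 with h | h <;> rw [h] <;> simp
      rw [h3] at hα hβ ⊢
      calc _ ≤ (β - α + 1) * (β - α + 1) := by gcongr
        _ = D * 1 := by rw [hD]; ring
    · have hD1 : β - α + 1 ≤ D := by rw [hD]; nlinarith
      rcases (Complex.mem_reProdIm.1 hw).1 with h | h
      · calc _ ≤ |w.im| * (β - α + 1) := by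
              gcongr
              · exact h2 α h
              · linarith
          _ ≤ D * |w.im| := by rw [mul_comm]; gcongr
      · calc _ ≤ (β - α + 1) * |w.im| := by
              gcongr
              · linarith
              · exact h2 β h
          _ ≤ D * |w.im| := by gcongr
  have hbound : ∀ w ∈ frontier U, ‖Q w‖ ≤ D * (3 * κ) := by
    intro w hw
    obtain ⟨h1, h2⟩ := hfront w hw
    have hkey : |w.im| * (‖F (Complex.exp (w * Complex.I)) -
        ∑ n ∈ Finset.range (n₀ + k), c n * Complex.exp (w * Complex.I) ^ n‖ *
          Real.exp ((n₀ + k : ℕ) * w.im)) ≤ 3 * κ := by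
      rcases lt_trichotomy w.im 0 with him | him | him
      · have := norm_remainder_outside_le (F := F) hn₀' hk (u := -w.im) (by linarith) (hnorm w)
          (hC w (frontier_subset_closure hw))
        rw [mul_neg, neg_neg] at this
        rw [abs_of_neg him]
        linarith
      · rw [him]; simp; positivity
      · have := norm_remainder_inside_le hF (N := n₀ + k) (fun n hn => hn₀' n (by lia)) him
          ((le_abs_self _).trans h2) (hnorm w)
        rwa [abs_of_pos him]
    rw [hQnorm]
    calc _ ≤ ‖F (Complex.exp (w * Complex.I)) -
        ∑ n ∈ Finset.range (n₀ + k), c n * Complex.exp (w * Complex.I) ^ n‖ *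
          Real.exp ((n₀ + k : ℕ) * w.im) * (D * |w.im|) := by gcongr
      _ = D * (|w.im| * (‖F (Complex.exp (w * Complex.I)) -
        ∑ n ∈ Finset.range (n₀ + k), c n * Complex.exp (w * Complex.I) ^ n‖ *
          Real.exp ((n₀ + k : ℕ) * w.im))) := by ring
      _ ≤ _ := by gcongr
  have hxU : (x : ℂ) ∈ closure U := by
    rw [hcl, Complex.mem_reProdIm]
    simp only [Complex.ofReal_re, Complex.ofReal_im]
    exact ⟨⟨by linarith [hx.1], by linarith [hx.2]⟩, by norm_num, by norm_num⟩
  have hfin := Complex.norm_le_of_forall_mem_frontier_norm_le hUb hdiff hbound hxU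
  rw [hQnorm, Complex.ofReal_im, mul_zero, Real.exp_zero, mul_one] at hfin
  have hfac : (a - α) * (β - b) ≤ ‖(x : ℂ) - α‖ * ‖(x : ℂ) - β‖ := by
    rw [← Complex.ofReal_sub, ← Complex.ofReal_sub, Complex.norm_real, Complex.norm_real,
      Real.norm_of_nonneg (by linarith [hx.1]), Real.norm_of_nonpos (by linarith [hx.2])]
    have := hx.1
    have := hx.2
    exact mul_le_mul (by linarith) (by linarith) (by linarith) (by linarith)
  have hε' : D * (3 * κ) = ε * ((a - α) * (β - b)) := by
    rw [hκ]; field_simp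
  rw [hε'] at hfin
  refine le_of_mul_le_mul_right (le_trans ?_ hfin) hρ
  gcongr

end FatouRiesz

/-! ### The singular measure -/

lemma blockMeasure_real_univ {R : ℝ} (hR : 0 ≤ R) (E : Set Torus) :
    (blockMeasure R E).real Set.univ = R * (AddCircle.haarAddCircle : Measure Torus).real E := by
  rw [measureReal_def, blockMeasure, Measure.smul_apply, Measure.restrict_apply_univ, smul_eq_mul,
    ENNReal.toReal_mul, ENNReal.toReal_ofReal hR, measureReal_def]

lemma taylorCoeff_expHerglotz_zero (μ : Measure Torus) [IsFiniteMeasure μ] :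
    taylorCoeff (expHerglotz μ) 0 = (Real.exp (μ.real Set.univ) : ℂ) := by
  rw [taylorCoeff_zero, expHerglotz, herglotz_zero_apply, Complex.ofReal_exp]

/-- There is a nonzero finite measure on the circle with Lebesgue null closed support, for which
the Taylor coefficients of `exp (∫ (e^{it} + z) / (e^{it} - z) dμ(t))` tend to zero. -/
lemma exists_measure_null_support :
    ∃ μ : Measure Torus, IsFiniteMeasure μ ∧ μ ≠ 0 ∧
      (AddCircle.haarAddCircle : Measure Torus) μ.support = 0 ∧
      Tendsto (taylorCoeff (expHerglotz μ)) atTop (𝓝 0) := by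
  obtain ⟨R, hR0, hRmono, hRtop, hRε⟩ := exists_slow_densities
  obtain ⟨E, M, hE0, hEc, hEanti, hkM, hM, htail, hlow, hall⟩ := exists_nested_sets hR0 hRmono
  have hRpos : ∀ k, 0 < R k := fun k => by
    have := hRmono.monotone (Nat.zero_le k)
    linarith
  set x : ℕ → ℕ → ℂ := fun k n => taylorCoeff (expHerglotz (blockMeasure (R k) (E k))) n with hx
  -- the zeroth coefficient is the exponential of the mass, and it starts from `e`
  have hmass0 : ∀ k,
      |Real.exp ((blockMeasure (R k) (E k)).real Set.univ) - Real.exp 1| ≤ 1 / 2 := by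
    intro k
    have h := norm_sub_le_of_frequency_le (x := x) hM hlow (k := 0) (n := 0) (Nat.zero_le _)
      (Nat.zero_le k)
    have h0 : (blockMeasure (R 0) (E 0)).real Set.univ = 1 := by
      rw [blockMeasure_real_univ (hRpos 0).le, hR0, hE0, probReal_univ, mul_one]
    simp only [hx, taylorCoeff_expHerglotz_zero] at h
    rw [h0, ← Complex.ofReal_sub, Complex.norm_real] at h
    simpa using h
  have he : 2 < Real.exp 1 := by linarith [Real.exp_one_gt_d9]
  have hmass2 : ∀ k, (blockMeasure (R k) (E k)).real Set.univ ≤ 2 := by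
    intro k
    have h1 := (abs_le.1 (hmass0 k)).2
    have h2 : Real.exp 2 = Real.exp 1 * Real.exp 1 := by rw [← Real.exp_add]; norm_num
    rw [← Real.exp_le_exp]
    nlinarith
  have hne : ∀ k, blockMeasure (R k) (E k) ≠ 0 := by
    intro k h0
    have h1 := (abs_le.1 (hmass0 k)).1
    rw [h0] at h1
    simp only [measureReal_zero, Pi.zero_apply, Real.exp_zero] at h1
    linarith
  obtain ⟨μ, φ, hμ, hφ, hlim, hsupp⟩ :=
    exists_weak_limit (fun k => blockMeasure (R k) (E k)) hmass2 hne
  have hptw : ∀ z : ℂ, ‖z‖ < 1 → Tendsto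
      (fun j => expHerglotz (blockMeasure (R (φ j)) (E (φ j))) z) atTop (𝓝 (expHerglotz μ z)) :=
    fun z hz => (Complex.continuous_exp.tendsto _).comp
      (hlim ⟨herglotzKernel z, continuous_herglotzKernel hz⟩)
  have hcoeff : ∀ n, Tendsto (fun j => x (φ j) n) atTop (𝓝 (taylorCoeff (expHerglotz μ) n)) := by
    intro n
    refine tendsto_coeff_of_tendsto (hasSum_expHerglotz μ)
      (fun j => hasSum_expHerglotz (blockMeasure (R (φ j)) (E (φ j)))) (r := 1 / 2) (by norm_num)
      (by norm_num) (M := Real.exp (3 * 2)) (fun j z hz => ?_)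
      (fun z hz => hptw z (by rw [hz]; norm_num)) n
    rw [expHerglotz, Complex.norm_exp, Real.exp_le_exp]
    have h1 := norm_herglotz_le (blockMeasure (R (φ j)) (E (φ j))) (z := z)
      (by rw [hz]; norm_num)
    rw [hz] at h1
    have h2 := hmass2 (φ j)
    have h3 := (Complex.re_le_norm (herglotz (blockMeasure (R (φ j)) (E (φ j))) z))
    norm_num at h1
    linarith
  refine ⟨μ, hμ, ?_, ?_, tendsto_zero_of_separated_changes hM hkM htail hlow hall hRε
    hφ.tendsto_atTop hcoeff⟩
  · rintro rfl
    have h1 := (hcoeff 0).norm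
    rw [taylorCoeff_expHerglotz_zero] at h1
    have h2 : Real.exp 1 - 1 / 2 ≤
        ‖(Real.exp ((0 : Measure Torus).real Set.univ) : ℂ)‖ := by
      refine ge_of_tendsto' h1 fun j => ?_
      simp only [hx, taylorCoeff_expHerglotz_zero]
      rw [Complex.norm_real, Real.norm_of_nonneg (Real.exp_pos _).le]
      linarith [(abs_le.1 (hmass0 (φ j))).1]
    simp at h2
    linarith
  · have hsub : ∀ k, μ.support ⊆ E k := fun k => by
      refine Measure.support_subset_of_isClosed (hEc k) (mem_ae_iff.2 (hsupp _ (hEc k) ?_))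
      filter_upwards [eventually_ge_atTop k] with j hj
      rw [blockMeasure, Measure.smul_apply,
        Measure.restrict_apply (hEc k).isOpen_compl.measurableSet, Set.disjoint_iff_inter_eq_empty.1
        (Set.disjoint_compl_left_iff_subset.2 (hEanti hj))]
      simp
    rw [← measureReal_eq_zero_iff]
    refine le_antisymm ?_ measureReal_nonneg
    have h2 : Tendsto (fun k => 2 / R k) atTop (𝓝 0) := hRtop.const_div_atTop 2
    refine ge_of_tendsto' h2 fun k => ?_
    refine (measureReal_mono (hsub k)).trans ?_
    rw [le_div_iff₀ (hRpos k), mul_comm, ← blockMeasure_real_univ (hRpos k).le]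
    exact hmass2 k

/-! ### Structure of the support -/

/-- If the coefficients of `exp (herglotz μ)` are bounded, its growth along a radius is at most
`B / (1 - r)`, whereas an atom of `μ` would cause exponential growth. -/
lemma measure_singleton_eq_zero_of_bounded_coeff (μ : Measure Torus) [IsFiniteMeasure μ] {B : ℝ}
    (hB : ∀ n, ‖taylorCoeff (expHerglotz μ) n‖ ≤ B) (t : Torus) : μ {t} = 0 := by
  rw [← measureReal_eq_zero_iff]
  by_contra hne
  set a := μ.real {t} with ha
  have ha0 : 0 < a := lt_of_le_of_ne measureReal_nonneg (Ne.symm hne)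
  have hB0 : 0 ≤ B := (norm_nonneg _).trans (hB 0)
  have key : ∀ X : ℝ, 1 < X → Real.exp (a * X) ≤ B * X := by
    intro X hX
    set r : ℝ := 1 - 1 / X with hr
    have hX0 : 0 < X := by linarith
    have hr1 : r < 1 := by
      have : 0 < 1 / X := by positivity
      linarith
    have hr0 : 0 < r := by
      have : 1 / X < 1 := by rw [div_lt_one hX0]; exact hX
      linarith
    have h1r : 1 - r = 1 / X := by rw [hr]; ring
    set z : ℂ := r * (AddCircle.toCircle t : ℂ) with hz
    have hznorm : ‖z‖ = r := norm_real_mul_toCircle hr0.le t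
    have hz1 : ‖z‖ < 1 := by rw [hznorm]; exact hr1
    have hupper : ‖expHerglotz μ z‖ ≤ B * X := by
      have hg := (hasSum_geometric_of_lt_one hr0.le hr1).mul_left B
      rw [h1r, one_div, inv_inv] at hg
      rw [← (hasSum_expHerglotz μ z hz1).tsum_eq]
      refine tsum_of_norm_bounded hg fun n => ?_
      rw [norm_mul, norm_pow, hznorm]
      exact mul_le_mul_of_nonneg_right (hB n) (by positivity)
    refine le_trans ?_ hupper
    rw [expHerglotz, Complex.norm_exp, Real.exp_le_exp, re_herglotz hz1]
    have hker : (herglotzKernel z t).re = (1 + r) * X := by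
      have e1 : (AddCircle.toCircle t : ℂ) - z =
          ((1 - r : ℝ) : ℂ) * (AddCircle.toCircle t : ℂ) := by
        rw [hz]; push_cast; ring
      rw [re_herglotzKernel, hznorm, e1, norm_mul, Circle.norm_coe, mul_one, Complex.norm_real,
        Real.norm_of_nonneg (by linarith)]
      have h2 : 1 - r ^ 2 = (1 + r) * (1 - r) := by ring
      rw [h2, h1r]
      field_simp
    calc a * X ≤ a * ((1 + r) * X) := by
          gcongr
          nlinarith
      _ = ∫ s in {t}, (herglotzKernel z s).re ∂μ := by
          rw [integral_singleton, hker, smul_eq_mul]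
      _ ≤ ∫ s, (herglotzKernel z s).re ∂μ :=
          setIntegral_le_integral (integrable_herglotzKernel hz1).re
            (ae_of_all _ fun s => re_herglotzKernel_nonneg hz1.le s)
  have h1 := key (2 * B / a ^ 2 + 2) (by have : 0 ≤ 2 * B / a ^ 2 := by positivity
                                         linarith)
  set X := 2 * B / a ^ 2 + 2 with hX
  have hX0 : 0 < X := by positivity
  have h2 := Real.quadratic_le_exp_of_nonneg (x := a * X) (by positivity)
  have h3 : a ^ 2 * X = 2 * B + 2 * a ^ 2 := by rw [hX]; field_simp
  have h4 : (a * X) ^ 2 / 2 = B * X + a ^ 2 * X := by linear_combination (X / 2) * h3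
  nlinarith [mul_pos ha0 hX0, mul_pos (pow_pos ha0 2) hX0]

lemma preperfect_support {μ : Measure Torus} (h : ∀ t, μ {t} = 0) : Preperfect μ.support := by
  intro t ht
  rw [accPt_iff_nhds]
  intro U hU
  by_contra hcon
  push Not at hcon
  have hpos := (Measure.mem_support_iff_forall t).1 ht U hU
  have hsub : U ⊆ {t} ∪ μ.supportᶜ := fun s hs => by
    by_cases h1 : s ∈ μ.support
    · exact Or.inl (hcon s ⟨hs, h1⟩)
    · exact Or.inr h1
  have h0 := (measure_mono hsub).trans (measure_union_le (μ := μ) _ _)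
  rw [h t, Measure.measure_compl_support, add_zero] at h0
  exact (hpos.trans_le h0).false

lemma exists_notMem_of_haar_eq_zero {K : Set Torus}
    (hK : (AddCircle.haarAddCircle : Measure Torus) K = 0) {a b : ℝ} (hab : a < b) :
    ∃ p ∈ Set.Ioo a b, (p : Torus) ∉ K := by
  by_contra hcon
  push Not at hcon
  have hopen : IsOpen ((fun x : ℝ => (x : Torus)) '' Set.Ioo a b) :=
    QuotientAddGroup.isOpenMap_coe _ isOpen_Ioo
  have hpos := hopen.measure_pos (AddCircle.haarAddCircle : Measure Torus)
    ((Set.nonempty_Ioo.2 hab).image _)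
  have hsub : (fun x : ℝ => (x : Torus)) '' Set.Ioo a b ⊆ K := by
    rintro _ ⟨p, hp, rfl⟩
    exact hcon p hp
  exact (hpos.trans_le ((measure_mono hsub).trans hK.le)).false

/-- Two points of a null subset of the circle are separated by two points outside of it. -/
lemma isTotallyDisconnected_of_haar_eq_zero {K : Set Torus}
    (hK : (AddCircle.haarAddCircle : Measure Torus) K = 0) : IsTotallyDisconnected K := by
  intro S hSK hS x hx y hy
  by_contra hne
  obtain ⟨a, rfl⟩ := QuotientAddGroup.mk_surjective x
  obtain ⟨b, hb, rfl⟩ : ∃ b ∈ Set.Ico a (a + 2 * Real.pi), (b : Torus) = y := by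
    have := AddCircle.coe_image_Ico_eq (2 * Real.pi) a
    have hy' : y ∈ (Set.univ : Set Torus) := trivial
    rw [← this] at hy'
    exact hy'
  have hab : a < b := lt_of_le_of_ne hb.1 fun h => hne (by rw [h])
  obtain ⟨p, hp, hpK⟩ := exists_notMem_of_haar_eq_zero hK hab
  obtain ⟨q, hq, hqK⟩ := exists_notMem_of_haar_eq_zero hK hb.2
  -- removing the images of `p` and `q` splits the circle into two open arcs
  set U : Set Torus := (fun x : ℝ => (x : Torus)) '' Set.Ioo (q - 2 * Real.pi) p with hU
  set V : Set Torus := (fun x : ℝ => (x : Torus)) '' Set.Ioo p q with hV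
  have hUo : IsOpen U := QuotientAddGroup.isOpenMap_coe _ isOpen_Ioo
  have hVo : IsOpen V := QuotientAddGroup.isOpenMap_coe _ isOpen_Ioo
  have hcover : S ⊆ U ∪ V := by
    intro s hs
    obtain ⟨s', hs', rfl⟩ : ∃ b ∈ Set.Ico (q - 2 * Real.pi) (q - 2 * Real.pi + 2 * Real.pi),
        (b : Torus) = s := by
      have := AddCircle.coe_image_Ico_eq (2 * Real.pi) (q - 2 * Real.pi)
      have hs'' : s ∈ (Set.univ : Set Torus) := trivial
      rw [← this] at hs''
      exact hs''
    rw [sub_add_cancel] at hs'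
    have h1 : s' ≠ q - 2 * Real.pi := by
      rintro rfl
      apply hqK
      have : ((q - 2 * Real.pi : ℝ) : Torus) = (q : Torus) := by
        rw [AddCircle.coe_sub, AddCircle.coe_period, sub_zero]
      rw [← this]
      exact hSK hs
    have h2 : s' ≠ p := by
      rintro rfl
      exact hpK (hSK hs)
    rcases lt_or_gt_of_ne h2 with h | h
    · exact Or.inl ⟨s', ⟨lt_of_le_of_ne hs'.1 (Ne.symm h1), h⟩, rfl⟩
    · exact Or.inr ⟨s', ⟨h, hs'.2⟩, rfl⟩
  obtain ⟨s, -, ⟨u, hu, hus⟩, v, hv, hvs⟩ := hS U V hUo hVo hcover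
    ⟨_, hx, a, ⟨by linarith [hq.2], hp.1⟩, rfl⟩ ⟨_, hy, b, ⟨hp.2, hq.1⟩, rfl⟩
  have huv : u = v := by
    refine (AddCircle.coe_eq_coe_iff_of_mem_Ico (p := 2 * Real.pi) (a := q - 2 * Real.pi) ?_ ?_).1
      (hus.trans hvs.symm)
    · exact ⟨hu.1.le, by linarith [hu.2, hp.2, hq.1]⟩
    · exact ⟨by linarith [hv.1, hu.1, hu.2], by linarith [hv.2]⟩
  linarith [hu.2, hv.1]

/-! ### Boundary values -/

lemma toCircle_coe_eq_exp (x : ℝ) :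
    (AddCircle.toCircle (x : Torus) : ℂ) = Complex.exp (x * Complex.I) := by
  rw [AddCircle.toCircle_apply_mk, Circle.coe_exp, div_self Real.two_pi_pos.ne', one_mul]

/-- On the unit circle the Herglotz kernel is purely imaginary, so that `expHerglotz μ` is
unimodular. This includes the points where the integral diverges and has the value `0`. -/
lemma norm_expHerglotz_toCircle (μ : Measure Torus) (t : Torus) :
    ‖expHerglotz μ (AddCircle.toCircle t : ℂ)‖ = 1 := by
  rw [expHerglotz, Complex.norm_exp, Real.exp_eq_one_iff, herglotz]
  by_cases h : Integrable (herglotzKernel (AddCircle.toCircle t : ℂ)) μ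
  · have h1 := integral_re h
    simp only [RCLike.re_eq_complex_re] at h1
    rw [← h1]
    simp [re_herglotzKernel, Circle.norm_coe]
  · rw [integral_undef h, Complex.zero_re]

lemma differentiableAt_expHerglotz_of_notMem {μ : Measure Torus} [IsFiniteMeasure μ]
    {K : Set Torus} (hK : IsCompact K) (hμK : μ Kᶜ = 0) {z : ℂ}
    (hz : ∀ t ∈ K, (AddCircle.toCircle t : ℂ) ≠ z) : DifferentiableAt ℂ (expHerglotz μ) z := by
  have hnot : z ∈ ((fun t : Torus => (AddCircle.toCircle t : ℂ)) '' K)ᶜ := by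
    rintro ⟨t, ht, htz⟩
    exact hz t ht htz
  have hopen := (hK.image continuous_toCircle_coe).isClosed.isOpen_compl
  obtain ⟨δ, hδ, hball⟩ := Metric.isOpen_iff.1 hopen z hnot
  refine (differentiableAt_herglotz μ hδ ?_).cexp
  filter_upwards [mem_ae_iff.2 hμK] with t ht
  by_contra hlt
  have hmem : (AddCircle.toCircle t : ℂ) ∈ Metric.ball z δ := by
    rw [Metric.mem_ball, dist_eq_norm]
    exact not_le.1 hlt
  exact hball hmem ⟨t, ht, rfl⟩

/-- Off the support, `expHerglotz μ` has radial limits equal to its values on the circle. -/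
lemma tendsto_expHerglotz_radial {μ : Measure Torus} [IsFiniteMeasure μ]
    {K : Set Torus} (hK : IsCompact K) (hμK : μ Kᶜ = 0) {t : Torus} (ht : t ∉ K) {r : ℕ → ℝ}
    (hr : Tendsto r atTop (𝓝 1)) :
    Tendsto (fun j => expHerglotz μ (r j * (AddCircle.toCircle t : ℂ))) atTop
      (𝓝 (expHerglotz μ (AddCircle.toCircle t : ℂ))) := by
  have hd := (differentiableAt_expHerglotz_of_notMem (z := (AddCircle.toCircle t : ℂ)) hK hμK
    fun s hs h => ht <| by rwa [← AddCircle.injective_toCircle Real.two_pi_pos.ne'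
      (Circle.coe_injective h)]).continuousAt
  refine hd.tendsto.comp ?_
  have h1 : Tendsto (fun j => ((r j : ℝ) : ℂ)) atTop (𝓝 ((1 : ℝ) : ℂ)) :=
    (Complex.continuous_ofReal.tendsto 1).comp hr
  simpa using h1.mul_const (AddCircle.toCircle t : ℂ)

/-- The boundary function is not in `H²`. It is the complex conjugate of the boundary function of
`G = 1 / expHerglotz μ`, so its Fourier coefficients of negative order are the conjugates of the
Taylor coefficients of `G`. If these vanished, `G` would be a constant of modulus `e^{-μ(𝕋)} < 1`,
while its boundary function is unimodular. -/
lemma not_memHardyTwo_expHerglotz {μ : Measure Torus} [IsFiniteMeasure μ] (hμ : μ ≠ 0)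
    {K : Set Torus} (hK : IsCompact K) (hμK : μ Kᶜ = 0)
    (hK0 : (AddCircle.haarAddCircle : Measure Torus) K = 0) :
    ¬ MemHardyTwo fun t => expHerglotz μ (AddCircle.toCircle t : ℂ) := by
  rintro ⟨-, hcoeff⟩
  set f : Torus → ℂ := fun t => expHerglotz μ (AddCircle.toCircle t : ℂ) with hf
  set r : ℕ → ℝ := fun j => 1 - 1 / ((j : ℝ) + 1) with hrdef
  have hr0 : ∀ j, 0 ≤ r j := fun j => by
    have : 1 / ((j : ℝ) + 1) ≤ 1 := (div_le_one (by positivity)).2 (by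
      have : (0 : ℝ) ≤ j := j.cast_nonneg
      linarith)
    simp only [hrdef]
    linarith
  have hr1 : ∀ j, r j < 1 := fun j => by
    have : 0 < 1 / ((j : ℝ) + 1) := by positivity
    simp only [hrdef]
    linarith
  have hr : Tendsto r atTop (𝓝 1) := by
    simpa [hrdef] using (tendsto_one_div_add_atTop_nhds_zero_nat (𝕜 := ℝ)).const_sub 1
  set G : ℂ → ℂ := fun z => (expHerglotz μ z)⁻¹ with hG
  have hGd : DifferentiableOn ℂ G (Metric.ball 0 1) :=
    (differentiableOn_expHerglotz μ).inv fun z _ => Complex.exp_ne_zero _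
  have hGs := hasSum_taylorCoeff hGd
  have hG1 : ∀ z : ℂ, ‖z‖ < 1 → ‖G z‖ ≤ 1 := by
    intro z hz
    rw [hG]
    simp only [norm_inv]
    refine inv_le_one_of_one_le₀ ?_
    rw [expHerglotz, Complex.norm_exp, Real.one_le_exp_iff, re_herglotz hz]
    exact integral_nonneg fun t => re_herglotzKernel_nonneg hz.le t
  have hae : ∀ᵐ t ∂(AddCircle.haarAddCircle : Measure Torus), t ∉ K :=
    measure_eq_zero_iff_ae_notMem.1 hK0
  -- unimodularity turns the reciprocal into the conjugate
  have hconj : ∀ t, (f t)⁻¹ = (starRingEnd ℂ) (f t) := fun t => by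
    rw [Complex.inv_def, Complex.normSq_eq_norm_sq, norm_expHerglotz_toCircle]
    simp
  have hlimG : ∀ t ∉ K, Tendsto (fun j => G (r j * (AddCircle.toCircle t : ℂ))) atTop
      (𝓝 ((starRingEnd ℂ) (f t))) := fun t ht => by
    rw [← hconj]
    exact (tendsto_expHerglotz_radial hK hμK ht hr).inv₀ (Complex.exp_ne_zero _)
  have hg : ∀ n : ℕ, 1 ≤ n → taylorCoeff G n = 0 := by
    intro n hn
    have h1 : Tendsto (fun j => fourierCoeff
        (fun t : Torus => G (r j * (AddCircle.toCircle t : ℂ))) n) atTop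
        (𝓝 (fourierCoeff (fun t => (starRingEnd ℂ) (f t)) n)) := by
      refine tendsto_integral_of_dominated_convergence (fun _ => 1) (fun j => ?_)
        (integrable_const 1) (fun j => ae_of_all _ fun t => ?_) ?_
      · exact (((fourier (-(n : ℤ))).continuous.smul
          (continuous_comp_circle hGs (hr0 j) (hr1 j)))).aestronglyMeasurable
      · rw [norm_smul, fourier_apply, Circle.norm_coe, one_mul]
        exact hG1 _ (by rw [norm_real_mul_toCircle (hr0 j)]; exact hr1 j)
      · filter_upwards [hae] with t ht
        exact (hlimG t ht).const_smul _
    have h2 : fourierCoeff (fun t => (starRingEnd ℂ) (f t)) n = 0 := by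
      have h3 := congrArg (starRingEnd ℂ) (hcoeff n hn)
      rw [map_zero, fourierCoeff, ← integral_conj] at h3
      rw [← h3, fourierCoeff]
      congr 1
      funext t
      rw [smul_eq_mul, smul_eq_mul, map_mul, ← fourier_neg, neg_neg]
    simp_rw [fun j => fourierCoeff_comp_circle_natCast hGs (hr0 j) (hr1 j) n, h2] at h1
    have h4 : Tendsto (fun j => taylorCoeff G n * (r j : ℂ) ^ n) atTop
        (𝓝 (taylorCoeff G n * ((1 : ℝ) : ℂ) ^ n)) :=
      (((Complex.continuous_ofReal.tendsto 1).comp hr).pow n).const_mul _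
    simpa using tendsto_nhds_unique h4 h1
  have hGconst : ∀ z : ℂ, ‖z‖ < 1 → G z = G 0 := by
    intro z hz
    rw [← taylorCoeff_zero G]
    refine (hGs z hz).unique ?_
    convert! hasSum_single (f := fun n => taylorCoeff G n * z ^ n) 0 ?_ using 1
    · simp
    · intro n hn
      simp only [hg n (by lia), zero_mul]
  obtain ⟨t, ht⟩ := hae.exists
  have h1 : Tendsto (fun j => G (r j * (AddCircle.toCircle t : ℂ))) atTop (𝓝 (G 0)) := by
    refine tendsto_const_nhds.congr fun j => (hGconst _ ?_).symm
    rw [norm_real_mul_toCircle (hr0 j)]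
    exact hr1 j
  have h2 := congrArg norm (tendsto_nhds_unique h1 (hlimG t ht))
  rw [RCLike.norm_conj, norm_expHerglotz_toCircle] at h2
  simp only [hG] at h2
  rw [expHerglotz, herglotz_zero_apply, norm_inv, ← Complex.ofReal_exp, Complex.norm_real,
    Real.norm_of_nonneg (Real.exp_pos _).le, inv_eq_one, Real.exp_eq_one_iff,
    measureReal_eq_zero_iff, Measure.measure_univ_eq_zero] at h2
  exact hμ h2

/-- Uniform convergence to the boundary function on the arcs that avoid the support. -/
lemma tendstoUniformlyOn_boundaryPartialSum {μ : Measure Torus} [IsFiniteMeasure μ]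
    {K : Set Torus} (hK : IsCompact K) (hμK : μ Kᶜ = 0)
    (hc : Tendsto (taylorCoeff (expHerglotz μ)) atTop (𝓝 0)) {a b : ℝ}
    (hab : Disjoint (closedArc a b) K) :
    TendstoUniformlyOn (fun N => boundaryPartialSum (taylorCoeff (expHerglotz μ)) N)
      (fun t => expHerglotz μ (AddCircle.toCircle t : ℂ)) atTop (closedArc a b) := by
  rcases lt_or_ge b a with hba | hab'
  · rw [closedArc, Set.Icc_eq_empty (not_le.2 hba), Set.image_empty]
    exact tendstoUniformlyOn_empty
  have hsub : Set.Icc a b ⊆ ((fun x : ℝ => (x : Torus)) ⁻¹' K)ᶜ := fun x hx hxK =>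
    Set.disjoint_left.1 hab ⟨x, hx, rfl⟩ hxK
  have hopen : IsOpen ((fun x : ℝ => (x : Torus)) ⁻¹' K)ᶜ :=
    (hK.isClosed.preimage (AddCircle.continuous_mk' _)).isOpen_compl
  obtain ⟨δ, hδ, hthick⟩ := isCompact_Icc.exists_cthickening_subset_open hopen hsub
  rw [Metric.tendstoUniformlyOn_iff]
  intro ε hε
  have hFR := fatou_riesz hc (hasSum_expHerglotz μ) (α := a - δ) (a := a) (b := b) (β := b + δ)
    (by linarith) (by linarith) ?_ (half_pos hε)
  · filter_upwards [hFR] with N hN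
    rintro _ ⟨x, hx, rfl⟩
    rw [dist_eq_norm, boundaryPartialSum]
    simp only [toCircle_coe_eq_exp]
    exact (hN x hx).trans_lt (half_lt_self hε)
  · intro w hw
    rw [Complex.mem_reProdIm] at hw
    refine differentiableAt_expHerglotz_of_notMem hK hμK fun t htK ht => ?_
    have him : w.im = 0 := by
      have := congrArg norm ht
      rw [Circle.norm_coe, Complex.norm_exp] at this
      simpa using this.symm
    have hre : w = (w.re : ℂ) := by
      apply Complex.ext <;> simp [him]
    rw [hre, ← toCircle_coe_eq_exp] at ht
    have ht' := AddCircle.injective_toCircle Real.two_pi_pos.ne' (Circle.coe_injective ht)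
    refine hthick ?_ (show ((w.re : ℝ) : Torus) ∈ K from ht' ▸ htK)
    refine Metric.mem_cthickening_of_dist_le _ (max a (min b w.re)) _ _
      ⟨le_max_left _ _, max_le hab' (min_le_left _ _)⟩ ?_
    rw [Real.dist_eq, abs_le]
    have h1 := hw.1.1
    have h2 := hw.1.2
    rcases max_cases a (min b w.re) with h | h <;> rcases min_cases b w.re with h' | h' <;>
      constructor <;> linarith

theorem theorem2 :
    ∃ (c : ℕ → ℂ) (f : Torus → ℂ) (G : ℂ → ℂ) (K : Set Torus) (μ : Measure Torus),
      -- the power series converges a.e. on the unit circle to `f`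
      (∀ᵐ t ∂(AddCircle.haarAddCircle : Measure Torus),
        Tendsto (fun N => boundaryPartialSum c N t) atTop (𝓝 (f t))) ∧
      -- `f` is in `L²`, indeed in `L^∞`, but not in `H²`
      MemLp f 2 (AddCircle.haarAddCircle : Measure Torus) ∧
      MemLp f ⊤ (AddCircle.haarAddCircle : Measure Torus) ∧
      ¬ MemHardyTwo f ∧
      -- the coefficients tend to zero
      Tendsto c atTop (𝓝 0) ∧
      -- in the open disk the sum is `1 / G`, with `G` singular inner and its measure on the
      -- Lebesgue-null Cantor set `K`
      IsCantorSet K ∧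
      (AddCircle.haarAddCircle : Measure Torus) K = 0 ∧
      IsSingularInner G μ ∧
      μ Kᶜ = 0 ∧
      (∀ z : ℂ, ‖z‖ < 1 → HasSum (fun n => c n * z ^ n) (1 / G z)) ∧
      -- uniform convergence on every closed arc that avoids `K`
      (∀ a b : ℝ, Disjoint (closedArc a b) K →
        TendstoUniformlyOn (fun N => boundaryPartialSum c N) f atTop (closedArc a b)) := by
  obtain ⟨μ, hμ, hμ0, hK0, hc⟩ := exists_measure_null_support
  set K : Set Torus := μ.support with hKdef
  have hKc : IsClosed K := Measure.isClosed_support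
  have hμK : μ Kᶜ = 0 := Measure.measure_compl_support
  have hunif := fun (a b : ℝ) (hab : Disjoint (closedArc a b) K) =>
    tendstoUniformlyOn_boundaryPartialSum hKc.isCompact hμK hc hab
  have hae : ∀ᵐ t ∂(AddCircle.haarAddCircle : Measure Torus),
      Tendsto (fun N => boundaryPartialSum (taylorCoeff (expHerglotz μ)) N t) atTop
        (𝓝 (expHerglotz μ (AddCircle.toCircle t : ℂ))) := by
    filter_upwards [measure_eq_zero_iff_ae_notMem.1 hK0] with t ht
    obtain ⟨x, rfl⟩ := QuotientAddGroup.mk_surjective t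
    refine (hunif x x ?_).tendsto_at ⟨x, ⟨le_rfl, le_rfl⟩, rfl⟩
    rw [closedArc, Set.Icc_self, Set.image_singleton, Set.disjoint_singleton_left]
    exact ht
  have hmeas : AEStronglyMeasurable (fun t : Torus => expHerglotz μ (AddCircle.toCircle t : ℂ))
      AddCircle.haarAddCircle := by
    refine aestronglyMeasurable_of_tendsto_ae atTop (fun N => ?_) hae
    refine Continuous.aestronglyMeasurable ?_
    unfold boundaryPartialSum
    have := continuous_toCircle_coe
    fun_prop
  have hLp : ∀ p : ENNReal, MemLp (fun t : Torus => expHerglotz μ (AddCircle.toCircle t : ℂ)) p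
      AddCircle.haarAddCircle := fun p =>
    MemLp.of_bound hmeas 1 (ae_of_all _ fun t => (norm_expHerglotz_toCircle μ t).le)
  obtain ⟨B, hB⟩ := hc.norm.bddAbove_range
  have hatom : ∀ t, μ {t} = 0 :=
    measure_singleton_eq_zero_of_bounded_coeff μ fun n => hB ⟨n, rfl⟩
  refine ⟨taylorCoeff (expHerglotz μ), fun t => expHerglotz μ (AddCircle.toCircle t : ℂ),
    fun z => Complex.exp (-herglotz μ z), K, μ, hae, hLp 2, hLp ⊤,
    not_memHardyTwo_expHerglotz hμ0 hKc.isCompact hμK hK0, hc,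
    ⟨Measure.nonempty_support hμ0, hKc.isCompact, preperfect_support hatom,
      isTotallyDisconnected_of_haar_eq_zero hK0⟩, hK0,
    ⟨hμ, hμ0, ⟨Kᶜ, hKc.measurableSet.compl, hμK, by rwa [compl_compl]⟩, fun z _ => rfl⟩, hμK,
    fun z hz => ?_, hunif⟩
  simp only [Complex.exp_neg, one_div, inv_inv]
  exact hasSum_expHerglotz μ z hz
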